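/- **Theorem 1.** Let $X^d=(X_1,\dots,X_d)$ be random variables with finite ranges $\mathcal X_1,\dots,\mathcal X_d$, not all of them one-point sets, and with a fixed joint distribution $P_{X^d}$ such that $P_{X_i}(x_i)>0$ for all $i$ and $x_i$. Let $\mathbf B$ be the symmetric matrix of size $m=\sum_i|\mathcal X_i|$ with blocks $\mathbf B_{ii}=\mathbf I$ and, for $i\ne j$, $$B_{ij}(x_i;x_j)=\frac{P_{X_iX_j}(x_i,x_j)}{\sqrt{P_{X_i}(x_i)}\sqrt{P_{X_j}(x_j)}},$$ and let $\lambda^{(0)}\ge\lambda^{(1)}\ge\dots\ge\lambda^{(m-1)}$ be its eigenvalues, counted with multiplicity (put $\lambda^{(2)}=0$ if $m=2$). Let $\psi^{(0)}$ be the unit vector with entries $\sqrt{P_{X_i}(x_i)/d}$, let $\psi^{(1)}$ be any unit eigenvector of $\mathbf B$ for $\lambda^{(1)}$ that is orthogonal to $\psi^{(0)}$, and let $f_i^{(1)}(x_i)=\psi_i^{(1)}(x_i)/\sqrt{P_{X_i}(x_i)}$, where $\psi^{(1)}_i$ is the $i$-th block of $\psi^{(1)}$. Let $\mathcal U$ be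 a finite set with $|\mathcal U|\ge2$, and let $0<\gamma<1/|\mathcal U|$. For a joint distribution of $(U,X^d)$ on $\mathcal U\times\mathcal X_1\times\dots\times\mathcal X_d$ put $$\mathcal L(X^d|U)=D(P_{X^d}\|P_{X_1}\cdots P_{X_d})-\sum_{u}P_U(u)\,D(P_{X^d|U=u}\|P_{X_1|U=u}\cdots P_{X_d|U=u}).$$ For $\delta>0$, call a joint distribution $P_{UX^d}$ feasible if its marginal on $X^d$ is the given $P_{X^d}$, $I(U;X^d)\le\delta$, and $\min_uP_U(u)>\gamma$. For a distribution $P_U$ on $\mathcal U$ let $\mathcal P_{\exp}^{(\delta)}(P_U)$ be the set of the distributions $$\frac1Z\,P_U(u)\,P_{X^d}(x^d)\exp\Big(\sqrt{2\delta}\,\frac{h(u)}{\sqrt{\lambda^{(1)}}}\sum_{i=1}^df_i^{(1)}(x_i)\Big),$$ where $h:\mathcal U\to\mathbb R$ has mean $0$ and variance $1$ under $P_U$, and $Z$ is the normalizing constant. All asymptotics are as $\delta\to0^+$. 1. The optimal value, that is, the (finite) supremum of $\mathcal L(X^d|U)$ over the feasible distributions, is $\delta(\lambda^{(1)}-1)+o(\delta)$.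 2. This value is attained, to the order of approximation of the statement, by the exponential family. The family $\mathcal P_{\exp}^{(\delta)}(P_U)$ is nonempty for every $\delta>0$ and every $P_U$ with $\min_uP_U(u)>\gamma$. Whenever $R^{(\delta)}\in\mathcal P_{\exp}^{(\delta)}(P_U^{(\delta)})$ with $\min_uP_U^{(\delta)}(u)>\gamma$ for all small $\delta$, the distribution $R^{(\delta)}$ has $I(U;X^d)=\delta+o(\delta)$, its marginals on $X^d$ and on $U$ differ from $P_{X^d}$ and $P^{(\delta)}_U$ by $O(\delta)$, and its value is $\mathcal L(X^d|U)=\delta(\lambda^{(1)}-1)+o(\delta)$. Moreover there are feasible distributions (for all small $\delta$) that are entrywise within $o(\sqrt\delta)$ of $R^{(\delta)}$ and have $\mathcal L(X^d|U)=\delta(\lambda^{(1)}-1)+o(\delta)$. 3. Suppose that $\lambda^{(1)}>1$ and $\lambda^{(1)}>\lambda^{(2)}$. If $P^{(\delta)}_{UX^d}$ is feasible for all small $\delta$, with $\mathcal L(X^d|U)=\delta(\lambda^{(1)}-1)+o(\delta)$, then there are $\hat P^{(\delta)}_{UX^d}\in\mathcal P_{\exp}^{(\delta)}(P^{(\delta)}_U)$,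 for all small $\delta$ and with $P_U^{(\delta)}$ the marginal of $P^{(\delta)}_{UX^d}$ on $U$, such that for all $(u,x^d)$ $$\big|P^{(\delta)}_{UX^d}(u,x^d)-\hat P^{(\delta)}_{UX^d}(u,x^d)\big|=o(\sqrt\delta).$$ -/

import Mathlib

open Filter Topology Asymptotics

noncomputable section

namespace TotalCorr

section Basic

variable {α : Type*} [Fintype α]

/-- Kullback-Leibler divergence `D(p ‖ q)` (natural logarithm) of two mass functions on a finite
set, with `0 log (0 / b) = 0`. It is only used below for `p` absolutely continuous with respect
to `q`: a joint law against the product of its own marginals. -/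
def kl (p q : α → ℝ) : ℝ := ∑ a, p a * Real.log (p a / q a)

end Basic

section Tuple

variable {d : ℕ} {X : Fin d → Type*} [∀ i, Fintype (X i)] [∀ i, DecidableEq (X i)]

/-- The marginal `P_{X_i}` of a joint law on `X_1 × ⋯ × X_d`. -/
def coordMarginal (P : (∀ i, X i) → ℝ) (i : Fin d) (a : X i) : ℝ :=
  ∑ x with x i = a, P x

/-- The pairwise marginal `P_{X_i X_j}`. -/
def pairMarginal (P : (∀ i, X i) → ℝ) (i j : Fin d) (a : X i) (b : X j) : ℝ :=
  ∑ x with x i = a ∧ x j = b, P x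

/-- Total correlation `D(P_{X^d} ‖ P_{X_1} ⋯ P_{X_d})`. -/
def totalCorrelation (P : (∀ i, X i) → ℝ) : ℝ :=
  kl P (fun x => ∏ i, coordMarginal P i (x i))

/-- The block matrix `B`, with rows and columns indexed by the disjoint union of the alphabets:
identity matrices on the diagonal, and the blocks
`P_{X_i X_j}(a, b) / (√P_{X_i}(a) √P_{X_j}(b))` off the diagonal. -/
def pairwiseMatrix (P : (∀ i, X i) → ℝ) : Matrix (Σ i, X i) (Σ i, X i) ℝ :=
  Matrix.of fun p q =>
    if p.1 = q.1 then (if p = q then 1 else 0)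
    else pairMarginal P p.1 q.1 p.2 q.2 /
      (Real.sqrt (coordMarginal P p.1 p.2) * Real.sqrt (coordMarginal P q.1 q.2))

theorem pairMarginal_comm (P : (∀ i, X i) → ℝ) (i j : Fin d) (a : X i) (b : X j) :
    pairMarginal P i j a b = pairMarginal P j i b a := by
  simp only [pairMarginal, and_comm]

theorem pairwiseMatrix_isHermitian (P : (∀ i, X i) → ℝ) : (pairwiseMatrix P).IsHermitian := by
  ext p q
  simp only [Matrix.conjTranspose_apply, pairwiseMatrix, Matrix.of_apply, star_trivial]
  by_cases h : p.1 = q.1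
  · simp only [h, if_true, eq_comm]
  · have h2 : ¬ q.1 = p.1 := fun e => h e.symm
    simp only [h, h2, if_false]
    rw [pairMarginal_comm, mul_comm]

/-- `eig P k` is `λ^{(k)}`: the eigenvalues of `B`, with multiplicity, in the order
`λ^{(0)} ≥ λ^{(1)} ≥ ⋯ ≥ λ^{(m-1)}`, where `m = ∑ i, |X_i|` (and `0` for `k ≥ m`). -/
def eig (P : (∀ i, X i) → ℝ) (k : ℕ) : ℝ :=
  if h : k < Fintype.card (Σ i, X i) then (pairwiseMatrix_isHermitian P).eigenvalues₀ ⟨k, h⟩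
  else 0

/-- The top eigenvector `ψ^{(0)} = d^{-1/2} [v_1; …; v_d]`, `v_i(a) = √P_{X_i}(a)`. -/
def psiZero (P : (∀ i, X i) → ℝ) : (Σ i, X i) → ℝ :=
  fun p => (Real.sqrt d)⁻¹ * Real.sqrt (coordMarginal P p.1 p.2)

/-- `ψ` is an admissible choice of `ψ^{(1)}`: a unit eigenvector of `B` for `λ^{(1)}`, orthogonal
to `ψ^{(0)}`. -/
structure IsSecondEigenvector (P : (∀ i, X i) → ℝ) (ψ : (Σ i, X i) → ℝ) : Prop where
  eigen : Matrix.mulVec (pairwiseMatrix P) ψ = eig P 1 • ψ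
  unit : ∑ p, ψ p ^ 2 = 1
  orthogonal : ∑ p, psiZero P p * ψ p = 0

/-- The function `f_i(a) = ψ_i(a) / √P_{X_i}(a)` attached to `ψ`. -/
def feature (P : (∀ i, X i) → ℝ) (ψ : (Σ i, X i) → ℝ) (i : Fin d) (a : X i) : ℝ :=
  ψ ⟨i, a⟩ / Real.sqrt (coordMarginal P i a)

end Tuple

section Attribute

variable {𝒰 : Type*} [Fintype 𝒰]

/-- The set `H` of functions of `U ∼ PU` with zero mean and unit variance. -/
def unitFunctions (PU : 𝒰 → ℝ) : Set (𝒰 → ℝ) :=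
  {h | ∑ u, PU u * h u = 0 ∧ ∑ u, PU u * h u ^ 2 = 1}

/-- The law of `U` under a joint law of `(U, X)`. -/
def marginalU {β : Type*} [Fintype β] (Q : 𝒰 × β → ℝ) (u : 𝒰) : ℝ := ∑ x, Q (u, x)

/-- The law of `X` under a joint law of `(U, X)`. -/
def marginalX {β : Type*} (Q : 𝒰 × β → ℝ) (x : β) : ℝ := ∑ u, Q (u, x)

/-- The conditional law of `X` given `U = u`. -/
def condX {β : Type*} [Fintype β] (Q : 𝒰 × β → ℝ) (u : 𝒰) (x : β) : ℝ :=
  Q (u, x) / marginalU Q u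

/-- Mutual information `I(U; X)`. -/
def mutualInfo {β : Type*} [Fintype β] (Q : 𝒰 × β → ℝ) : ℝ :=
  kl Q (fun z => marginalU Q z.1 * marginalX Q z.2)

variable {d : ℕ} {X : Fin d → Type*} [∀ i, Fintype (X i)] [∀ i, DecidableEq (X i)]

/-- `L(X^d | U) = D(P_{X^d} ‖ P_{X_1} ⋯ P_{X_d}) - D(P_{X^d} ‖ P_{X_1} ⋯ P_{X_d} | U)`, the
reduction of the total correlation of `X^d` by the knowledge of `U`. The second divergence is
the average over `u` of the total correlation of the conditional law of `X^d` given `U = u`. -/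
def reduction (Q : 𝒰 × (∀ i, X i) → ℝ) : ℝ :=
  totalCorrelation (marginalX Q) - ∑ u, marginalU Q u * totalCorrelation (condX Q u)

/-- The joint laws of `(U, X^d)` over which one maximizes: the law of `X^d` is the given `P`,
`I(U; X^d) ≤ δ` and `min_u P_U(u) > γ`. -/
def feasible (𝒰 : Type*) [Fintype 𝒰] (P : (∀ i, X i) → ℝ) (γ δ : ℝ) :
    Set (𝒰 × (∀ i, X i) → ℝ) :=
  {Q | Q ∈ stdSimplex ℝ (𝒰 × (∀ i, X i)) ∧ marginalX Q = P ∧ mutualInfo Q ≤ δ ∧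
    ∀ u, γ < marginalU Q u}

/-- The unnormalized member of the exponential family
`PU(u) P(x) exp (√(2δ) h(u) / √λ^{(1)} ∑ i, f_i(x_i))`. -/
def expWeight (P : (∀ i, X i) → ℝ) (ψ : (Σ i, X i) → ℝ) (PU : 𝒰 → ℝ) (δ : ℝ) (h : 𝒰 → ℝ) :
    𝒰 × (∀ i, X i) → ℝ :=
  fun z => PU z.1 * P z.2 *
    Real.exp (Real.sqrt (2 * δ) * (h z.1 / Real.sqrt (eig P 1)) * ∑ i, feature P ψ i (z.2 i))

/-- The exponential family of joint laws of `(U, X^d)` with base law `PU ⊗ P`. -/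
def expFamily (P : (∀ i, X i) → ℝ) (ψ : (Σ i, X i) → ℝ) (PU : 𝒰 → ℝ) (δ : ℝ) :
    Set (𝒰 × (∀ i, X i) → ℝ) :=
  {R | ∃ h ∈ unitFunctions PU,
    R = fun z => (∑ w, expWeight P ψ PU δ h w)⁻¹ * expWeight P ψ PU δ h z}

end Attribute

end TotalCorr

end

open TotalCorr

/-
A law `Q = P_U ⊗ P · (1 + ε)` with the prescribed marginal `P` and `I(U; X^d) ≤ δ` has
`ε = O(√δ)`, because the divergence dominates the squared Hellinger distance and `P_U` is bounded
below. To second order in `ε`, the mutual information is half the squared norm of `ε` in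
`L²(P_U ⊗ P)`, and `L(X^d | U)` is half of `E - ‖ε‖²`, where the energy `E` averages the sums over
`i` of the squared norms of the conditional expectations `E[ε(u, ·) | X_i]`. On centred functions
the energy is the quadratic form with eigenvalues `λ^{(1)} ≥ λ^{(2)} ≥ ⋯`, the nonzero eigenvalues
of `B` on the complement of `ψ^{(0)}`; hence `L(X^d | U) ≤ δ (λ^{(1)} - 1) + o(δ)`, with equality
to first order when `ε = √(2δ) h(u) / √λ^{(1)} ∑ i, f_i(x_i)`. Such an `ε` is realized by the
exponential family, and by its linearization, which has the exact marginals and becomes feasible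
after a multiplication of `ε` by a factor `1 - o(1)`. Under a spectral gap the part of `ε`
orthogonal to `∑ i, f_i` costs a fixed proportion of its squared norm, so it is `o(√δ)` for every
law that is optimal to first order.
-/

namespace TotalCorr

open InformationTheory Matrix

section Asymptotics

theorem klFun_one_add_sub_isLittleO :
    (fun t : ℝ => klFun (1 + t) - t ^ 2 / 2) =o[𝓝 0] fun t => t ^ 2 := by
  have hlog : (fun t : ℝ => Real.log (1 + t) - t + t ^ 2 / 2) =O[𝓝 0] fun t => t ^ 3 := by
    refine IsBigO.of_bound 2 ?_
    filter_upwards [Metric.ball_mem_nhds (0 : ℝ) (by norm_num : (0 : ℝ) < 1 / 2)] with t ht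
    rw [mem_ball_zero_iff, Real.norm_eq_abs] at ht
    have h := Real.abs_log_sub_add_sum_range_le (x := -t) (by rw [abs_neg]; linarith) 2
    norm_num [Finset.sum_range_succ] at h
    have hdiv : |t| ^ 3 / (1 - |t|) ≤ 2 * |t| ^ 3 := by
      rw [div_le_iff₀ (by linarith)]
      nlinarith [pow_nonneg (abs_nonneg t) 3]
    rw [norm_pow, Real.norm_eq_abs, Real.norm_eq_abs]
    refine le_trans (le_of_eq ?_) (h.trans hdiv)
    congr 1
    ring
  have hone : (fun t : ℝ => 1 + t) =O[𝓝 0] fun _ => (1 : ℝ) :=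
    Tendsto.isBigO_one ℝ (c := 1 + 0) ((continuous_const.add continuous_id).tendsto 0)
  have hcube : (fun t : ℝ => t ^ 3) =o[𝓝 0] fun t => t ^ 2 := isLittleO_pow_pow (by norm_num)
  have hprod := hone.mul_isLittleO (hlog.trans_isLittleO hcube)
  simp only [one_mul] at hprod
  refine (hprod.sub (hcube.const_mul_left (1 / 2))).congr_left fun t => ?_
  rw [klFun]
  ring

theorem sq_sqrt_sub_one_le_klFun {r : ℝ} (hr : 0 ≤ r) : (√r - 1) ^ 2 ≤ klFun r := by
  rcases hr.eq_or_lt with rfl | hr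
  · simp [klFun]
  have hlog := Real.one_sub_inv_le_log_of_pos (Real.sqrt_pos.2 hr)
  rw [Real.log_sqrt hr.le] at hlog
  have hcancel : r * (√r)⁻¹ = √r := by rw [← div_eq_mul_inv, Real.div_sqrt]
  have := mul_le_mul_of_nonneg_left hlog hr.le
  rw [klFun]
  linarith [Real.sq_sqrt hr.le]

variable {ι : Type*} {l : Filter ι}

theorem isLittleO_sq_sub_sq {f g s : ι → ℝ} (hf : f =O[l] s)
    (hfg : (fun i => f i - g i) =o[l] s) :
    (fun i => f i ^ 2 - g i ^ 2) =o[l] fun i => s i ^ 2 := by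
  have hg : (fun i => f i + g i) =O[l] s :=
    ((hf.const_mul_left 2).sub hfg.isBigO).congr_left fun i => by ring
  exact (hg.mul_isLittleO hfg).congr (fun i => by ring) fun i => by ring

variable {α : Type*} [Fintype α] {w : ι → α → ℝ}

theorem isBigO_one_of_mem_stdSimplex (hw : ∀ᶠ i in l, w i ∈ stdSimplex ℝ α) (a : α) :
    (fun i => w i a) =O[l] fun _ => (1 : ℝ) := by
  refine IsBigO.of_bound 1 ?_
  filter_upwards [hw] with i hi
  have := mem_Icc_of_mem_stdSimplex hi a
  simpa [abs_of_nonneg this.1] using this.2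

theorem isLittleO_sum_mul (hw : ∀ᶠ i in l, w i ∈ stdSimplex ℝ α) {f : ι → α → ℝ} {s : ι → ℝ}
    (hf : ∀ a, (fun i => f i a) =o[l] s) : (fun i => ∑ a, w i a * f i a) =o[l] s :=
  IsLittleO.fun_sum fun a _ =>
    ((isBigO_one_of_mem_stdSimplex hw a).mul_isLittleO (hf a)).congr_right fun _ => one_mul _

end Asymptotics

section KL

variable {α : Type*} [Fintype α] {p q r t : α → ℝ}

theorem kl_eq_sum_mul_klFun (hr : ∀ a, p a = q a * r a) (hsum : ∑ a, p a = ∑ a, q a) :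
    kl p q = ∑ a, q a * klFun (r a) := by
  have hterm : ∀ a, q a * klFun (r a) = p a * Real.log (p a / q a) + (q a - p a) := fun a => by
    rcases eq_or_ne (q a) 0 with hq | hq
    · simp [hr a, hq]
    · rw [hr a, mul_div_cancel_left₀ _ hq, klFun]
      ring
  rw [Finset.sum_congr rfl fun a _ => hterm a, Finset.sum_add_distrib, Finset.sum_sub_distrib,
    hsum, sub_self, add_zero, kl]

theorem kl_nonneg (hq : ∀ a, 0 ≤ q a) (hr0 : ∀ a, 0 ≤ r a) (hr : ∀ a, p a = q a * r a)
    (hsum : ∑ a, p a = ∑ a, q a) : 0 ≤ kl p q := by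
  rw [kl_eq_sum_mul_klFun hr hsum]
  exact Finset.sum_nonneg fun a _ => mul_nonneg (hq a) (klFun_nonneg (hr0 a))

theorem mul_sq_sqrt_sub_one_le_kl (hq : ∀ a, 0 ≤ q a) (hr0 : ∀ a, 0 ≤ r a)
    (hr : ∀ a, p a = q a * r a) (hsum : ∑ a, p a = ∑ a, q a) (a : α) :
    q a * (√(r a) - 1) ^ 2 ≤ kl p q := by
  rw [kl_eq_sum_mul_klFun hr hsum]
  calc q a * (√(r a) - 1) ^ 2 ≤ q a * klFun (r a) :=
        mul_le_mul_of_nonneg_left (sq_sqrt_sub_one_le_klFun (hr0 a)) (hq a)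
    _ ≤ ∑ a, q a * klFun (r a) :=
        Finset.single_le_sum (f := fun a => q a * klFun (r a))
          (fun a _ => mul_nonneg (hq a) (klFun_nonneg (hr0 a))) (Finset.mem_univ a)

theorem kl_mul_one_add_mul_le (hq : ∀ a, 0 ≤ q a) (ht : ∀ a, 0 ≤ 1 + t a)
    (hsum : ∑ a, q a * t a = 0) {θ : ℝ} (hθ : θ ∈ Set.Icc (0 : ℝ) 1) :
    kl (fun a => q a * (1 + θ * t a)) q ≤ θ * kl (fun a => q a * (1 + t a)) q := by
  have hmass : ∀ c : ℝ, ∑ a, q a * (1 + c * t a) = ∑ a, q a := fun c => by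
    rw [← add_zero (∑ a, q a), ← mul_zero c, ← hsum, Finset.mul_sum, ← Finset.sum_add_distrib]
    exact Finset.sum_congr rfl fun a _ => by ring
  rw [kl_eq_sum_mul_klFun (fun _ => rfl) (hmass θ),
    kl_eq_sum_mul_klFun (fun _ => rfl) (by simpa using hmass 1), Finset.mul_sum]
  refine Finset.sum_le_sum fun a _ => ?_
  have hconv : klFun (1 + θ * t a) ≤ θ * klFun (1 + t a) := by
    have h := convexOn_klFun.2 (Set.mem_Ici.2 (ht a)) (Set.mem_Ici.2 zero_le_one) hθ.1
      (sub_nonneg.2 hθ.2) (add_sub_cancel _ _)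
    simp only [smul_eq_mul, klFun_one, mul_zero, add_zero, mul_one] at h
    rwa [show θ * (1 + t a) + (1 - θ) = 1 + θ * t a by ring] at h
  calc q a * klFun (1 + θ * t a) ≤ q a * (θ * klFun (1 + t a)) :=
        mul_le_mul_of_nonneg_left hconv (hq a)
    _ = θ * (q a * klFun (1 + t a)) := mul_left_comm _ _ _

variable {ι : Type*} {l : Filter ι} {s : ι → ℝ} {p q t : ι → α → ℝ}

theorem kl_sub_isLittleO (hs : Tendsto s l (𝓝 0)) (hq : ∀ᶠ i in l, q i ∈ stdSimplex ℝ α)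
    (hp : ∀ᶠ i in l, ∀ a, p i a = q i a * (1 + t i a)) (hsum : ∀ᶠ i in l, ∑ a, p i a = 1)
    (ht : ∀ a, (fun i => t i a) =O[l] s) :
    (fun i => kl (p i) (q i) - (∑ a, q i a * t i a ^ 2) / 2) =o[l] fun i => s i ^ 2 := by
  have hterm : ∀ a, (fun i => klFun (1 + t i a) - t i a ^ 2 / 2) =o[l] fun i => s i ^ 2 :=
    fun a => (klFun_one_add_sub_isLittleO.comp_tendsto ((ht a).trans_tendsto hs)).trans_isBigO
      ((ht a).pow 2)
  refine (isLittleO_sum_mul hq hterm).congr' ?_ EventuallyEq.rfl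
  filter_upwards [hq, hp, hsum] with i hqi hpi hsumi
  rw [kl_eq_sum_mul_klFun hpi (hsumi.trans hqi.2.symm), Finset.sum_div, ← Finset.sum_sub_distrib]
  exact Finset.sum_congr rfl fun a _ => by ring

theorem kl_isLittleO (hs : Tendsto s l (𝓝 0)) (hq : ∀ᶠ i in l, q i ∈ stdSimplex ℝ α)
    (hp : ∀ᶠ i in l, ∀ a, p i a = q i a * (1 + t i a)) (hsum : ∀ᶠ i in l, ∑ a, p i a = 1)
    (ht : ∀ a, (fun i => t i a) =o[l] s) :
    (fun i => kl (p i) (q i)) =o[l] fun i => s i ^ 2 := by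
  have hsq : (fun i => ∑ a, q i a * t i a ^ 2) =o[l] fun i => s i ^ 2 :=
    isLittleO_sum_mul hq fun a => (ht a).pow two_pos
  refine ((kl_sub_isLittleO hs hq hp hsum fun a => (ht a).isBigO).add
    (hsq.const_mul_left (1 / 2))).congr_left fun i => ?_
  ring

end KL

section Joint

variable {𝒰 β : Type*}

theorem marginalU_nonneg [Fintype β] {Q : 𝒰 × β → ℝ} (hQ : ∀ z, 0 ≤ Q z) (u : 𝒰) :
    0 ≤ marginalU Q u :=
  Finset.sum_nonneg fun _ _ => hQ _

theorem marginalX_nonneg [Fintype 𝒰] {Q : 𝒰 × β → ℝ} (hQ : ∀ z, 0 ≤ Q z) (x : β) :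
    0 ≤ marginalX Q x :=
  Finset.sum_nonneg fun _ _ => hQ _

theorem le_marginalU [Fintype β] {Q : 𝒰 × β → ℝ} (hQ : ∀ z, 0 ≤ Q z) (u : 𝒰) (x : β) :
    Q (u, x) ≤ marginalU Q u :=
  Finset.single_le_sum (f := fun x => Q (u, x)) (fun _ _ => hQ _) (Finset.mem_univ x)

theorem le_marginalX [Fintype 𝒰] {Q : 𝒰 × β → ℝ} (hQ : ∀ z, 0 ≤ Q z) (u : 𝒰) (x : β) :
    Q (u, x) ≤ marginalX Q x :=
  Finset.single_le_sum (f := fun u => Q (u, x)) (fun _ _ => hQ _) (Finset.mem_univ u)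

theorem marginalU_of_eq_mul_one_add [Fintype β] {Q ε : 𝒰 × β → ℝ} {a : 𝒰 → ℝ} {b : β → ℝ}
    (hQ : ∀ z, Q z = a z.1 * b z.2 * (1 + ε z)) (hb : ∑ x, b x = 1) (u : 𝒰) :
    marginalU Q u = a u * (1 + ∑ x, b x * ε (u, x)) := by
  simp only [marginalU, hQ, mul_add, mul_one, Finset.sum_add_distrib, mul_assoc, ← Finset.mul_sum,
    hb]

theorem marginalX_of_eq_mul_one_add [Fintype 𝒰] {Q ε : 𝒰 × β → ℝ} {a : 𝒰 → ℝ} {b : β → ℝ}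
    (hQ : ∀ z, Q z = a z.1 * b z.2 * (1 + ε z)) (ha : ∑ u, a u = 1) (x : β) :
    marginalX Q x = b x * (1 + ∑ u, a u * ε (u, x)) := by
  simp only [marginalX, hQ, mul_comm (a _), mul_add, mul_one, Finset.sum_add_distrib, mul_assoc,
    ← Finset.mul_sum, ha]

variable [Fintype 𝒰] [Fintype β] {Q ε : 𝒰 × β → ℝ} {a : 𝒰 → ℝ} {b : β → ℝ}

theorem sum_marginalU_mul (Q : 𝒰 × β → ℝ) (g : 𝒰 → ℝ) :
    ∑ u, marginalU Q u * g u = ∑ z, Q z * g z.1 := by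
  simp only [marginalU, Fintype.sum_prod_type, Finset.sum_mul]

theorem sum_marginalX_mul (Q : 𝒰 × β → ℝ) (g : β → ℝ) :
    ∑ x, marginalX Q x * g x = ∑ z, Q z * g z.2 := by
  simp only [marginalX, Fintype.sum_prod_type_right, Finset.sum_mul]

theorem sum_marginalU (Q : 𝒰 × β → ℝ) : ∑ u, marginalU Q u = ∑ z, Q z := by
  simpa using sum_marginalU_mul Q 1

theorem sum_marginalX (Q : 𝒰 × β → ℝ) : ∑ x, marginalX Q x = ∑ z, Q z := by
  simpa using sum_marginalX_mul Q 1

theorem marginalU_mem_stdSimplex (hQ : Q ∈ stdSimplex ℝ (𝒰 × β)) :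
    marginalU Q ∈ stdSimplex ℝ 𝒰 :=
  ⟨marginalU_nonneg hQ.1, (sum_marginalU Q).trans hQ.2⟩

theorem marginalX_mem_stdSimplex (hQ : Q ∈ stdSimplex ℝ (𝒰 × β)) :
    marginalX Q ∈ stdSimplex ℝ β :=
  ⟨marginalX_nonneg hQ.1, (sum_marginalX Q).trans hQ.2⟩

theorem prod_mem_stdSimplex (ha : a ∈ stdSimplex ℝ 𝒰) (hb : b ∈ stdSimplex ℝ β) :
    (fun z : 𝒰 × β => a z.1 * b z.2) ∈ stdSimplex ℝ (𝒰 × β) := by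
  refine ⟨fun z => mul_nonneg (ha.1 _) (hb.1 _), ?_⟩
  simp only [Fintype.sum_prod_type, ← Finset.mul_sum, hb.2, mul_one, ha.2]

theorem eq_zero_of_marginalU_mul_marginalX_eq_zero (hQ : ∀ z, 0 ≤ Q z) {z : 𝒰 × β}
    (hz : marginalU Q z.1 * marginalX Q z.2 = 0) : Q z = 0 := by
  rcases mul_eq_zero.1 hz with hz | hz
  · exact le_antisymm (hz ▸ le_marginalU hQ z.1 z.2) (hQ z)
  · exact le_antisymm (hz ▸ le_marginalX hQ z.1 z.2) (hQ z)

theorem kl_prod_eq_mutualInfo_add (hQ : ∀ z, 0 ≤ Q z) (hab : ∀ z, a z.1 * b z.2 = 0 → Q z = 0) :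
    kl Q (fun z => a z.1 * b z.2) = mutualInfo Q + kl (marginalU Q) a + kl (marginalX Q) b := by
  simp only [mutualInfo, kl]
  rw [sum_marginalU_mul Q fun u => Real.log (marginalU Q u / a u),
    sum_marginalX_mul Q fun x => Real.log (marginalX Q x / b x),
    ← Finset.sum_add_distrib, ← Finset.sum_add_distrib]
  refine Finset.sum_congr rfl fun z _ => ?_
  rcases (hQ z).eq_or_lt with hz | hz
  · simp [← hz]
  have hu : marginalU Q z.1 ≠ 0 := (hz.trans_le (le_marginalU hQ z.1 z.2)).ne'
  have hx : marginalX Q z.2 ≠ 0 := (hz.trans_le (le_marginalX hQ z.1 z.2)).ne'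
  obtain ⟨ha, hb⟩ := mul_ne_zero_iff.1 (mt (hab z) hz.ne')
  rw [Real.log_div hz.ne' (mul_ne_zero ha hb), Real.log_div hz.ne' (mul_ne_zero hu hx),
    Real.log_div hu ha, Real.log_div hx hb, Real.log_mul hu hx, Real.log_mul ha hb]
  ring

/-- `Q i` is a law of `(U, X)` of the form `a i ⊗ b · (1 + ε i)`, where `ε` is of order `s → 0`
and its partial averages are of smaller order, so that `a i` and `b` are the marginals of `Q i`
up to terms that do not contribute to the second order. -/
structure IsPerturbation {ι : Type*} (l : Filter ι) (s : ι → ℝ) (a : ι → 𝒰 → ℝ) (b : β → ℝ)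
    (Q ε : ι → 𝒰 × β → ℝ) : Prop where
  tendsto : Tendsto s l (𝓝 0)
  left_mem : ∀ᶠ i in l, a i ∈ stdSimplex ℝ 𝒰
  right_mem : b ∈ stdSimplex ℝ β
  eq_mul : ∀ᶠ i in l, ∀ z, Q i z = a i z.1 * b z.2 * (1 + ε i z)
  sum_eq_one : ∀ᶠ i in l, ∑ z, Q i z = 1
  isBigO : ∀ z, (fun i => ε i z) =O[l] s
  sum_right_isLittleO : ∀ u, (fun i => ∑ x, b x * ε i (u, x)) =o[l] s
  sum_left_isLittleO : ∀ x, (fun i => ∑ u, a i u * ε i (u, x)) =o[l] s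

namespace IsPerturbation

variable {ι : Type*} {l : Filter ι} {s : ι → ℝ} {a : ι → 𝒰 → ℝ} {Q ε : ι → 𝒰 × β → ℝ}

theorem eventually_one_add_nonneg (h : IsPerturbation l s a b Q ε) :
    ∀ᶠ i in l, ∀ z, 0 ≤ 1 + ε i z := by
  refine eventually_all.2 fun z => ?_
  filter_upwards [((h.isBigO z).trans_tendsto h.tendsto).eventually_const_lt
    (neg_one_lt_zero (R := ℝ))] with i hi
  linarith

theorem eventually_nonneg (h : IsPerturbation l s a b Q ε) : ∀ᶠ i in l, ∀ z, 0 ≤ Q i z := by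
  filter_upwards [h.left_mem, h.eq_mul, h.eventually_one_add_nonneg] with i ha hQ hε z
  rw [hQ]
  exact mul_nonneg (mul_nonneg (ha.1 _) (h.right_mem.1 _)) (hε z)

theorem mutualInfo_sub_isLittleO (h : IsPerturbation l s a b Q ε) :
    (fun i => mutualInfo (Q i) - (∑ z : 𝒰 × β, a i z.1 * b z.2 * ε i z ^ 2) / 2)
      =o[l] fun i => s i ^ 2 := by
  have hprod : (fun i => kl (Q i) (fun z => a i z.1 * b z.2) -
      (∑ z : 𝒰 × β, a i z.1 * b z.2 * ε i z ^ 2) / 2) =o[l] fun i => s i ^ 2 :=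
    kl_sub_isLittleO h.tendsto (h.left_mem.mono fun i hi => prod_mem_stdSimplex hi h.right_mem)
      h.eq_mul h.sum_eq_one h.isBigO
  have hU : (fun i => kl (marginalU (Q i)) (a i)) =o[l] fun i => s i ^ 2 :=
    kl_isLittleO h.tendsto h.left_mem
      (h.eq_mul.mono fun i hi => marginalU_of_eq_mul_one_add hi h.right_mem.2)
      (h.sum_eq_one.mono fun i hi => (sum_marginalU _).trans hi) h.sum_right_isLittleO
  have hX : (fun i => kl (marginalX (Q i)) b) =o[l] fun i => s i ^ 2 :=
    kl_isLittleO h.tendsto (.of_forall fun _ => h.right_mem)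
      ((h.eq_mul.and h.left_mem).mono fun i hi => marginalX_of_eq_mul_one_add hi.1 hi.2.2)
      (h.sum_eq_one.mono fun i hi => (sum_marginalX _).trans hi) h.sum_left_isLittleO
  refine ((hprod.sub hU).sub hX).congr' ?_ EventuallyEq.rfl
  filter_upwards [h.eq_mul, h.eventually_nonneg] with i hQ hQ0
  rw [kl_prod_eq_mutualInfo_add hQ0 fun z hz => by rw [hQ, hz, zero_mul]]
  ring

end IsPerturbation

end Joint

theorem sum_fiberwise_mul {κ β : Type*} [Fintype β] [DecidableEq β] (t : Finset κ) (π : κ → β)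
    (f : κ → ℝ) (g : β → ℝ) : ∑ b, (∑ x ∈ t with π x = b, f x) * g b = ∑ x ∈ t, f x * g (π x) := by
  rw [← Finset.sum_fiberwise t π]
  refine Finset.sum_congr rfl fun b _ => ?_
  rw [Finset.sum_mul]
  exact Finset.sum_congr rfl fun x hx => by rw [(Finset.mem_filter.1 hx).2]

theorem log_div_prod_sub_log_div_prod {κ : Type*} [Fintype κ] {q u x : ℝ} {c m : κ → ℝ}
    (hq : q ≠ 0) (hu : u ≠ 0) (hx : x ≠ 0) (hc : ∀ i, c i ≠ 0) (hm : ∀ i, m i ≠ 0) :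
    Real.log (x / ∏ i, m i) - Real.log (q / u / ∏ i, c i / u) =
      ∑ i, Real.log (c i / (u * m i)) - Real.log (q / (u * x)) := by
  have hcu : ∀ i, c i / u ≠ 0 := fun i => div_ne_zero (hc i) hu
  rw [Real.log_div hx (Finset.prod_ne_zero_iff.2 fun i _ => hm i),
    Real.log_div (div_ne_zero hq hu) (Finset.prod_ne_zero_iff.2 fun i _ => hcu i),
    Real.log_div hq hu, Real.log_div hq (mul_ne_zero hu hx), Real.log_mul hu hx,
    Real.log_prod fun i _ => hm i, Real.log_prod fun i _ => hcu i]
  simp only [Real.log_div (hc _) hu, Real.log_div (hc _) (mul_ne_zero hu (hm _)),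
    Real.log_mul hu (hm _), Finset.sum_sub_distrib, Finset.sum_add_distrib]
  ring

section Coordinates

variable {d : ℕ} {X : Fin d → Type*} [∀ i, Fintype (X i)] [∀ i, DecidableEq (X i)]
  {P : (∀ i, X i) → ℝ}

/-- The conditional mean of `g(X^d)` given `X_i = a`. -/
noncomputable def condMean (P : (∀ i, X i) → ℝ) (i : Fin d) (g : (∀ i, X i) → ℝ) (a : X i) : ℝ :=
  (∑ x with x i = a, P x * g x) / coordMarginal P i a

/-- The sum over the coordinates of the second moments of the conditional means of `g`. This is
the quadratic form whose maximization, under a constraint on the variance of `g`, is governed by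
the spectrum of `pairwiseMatrix P`. -/
noncomputable def energy (P : (∀ i, X i) → ℝ) (g : (∀ i, X i) → ℝ) : ℝ :=
  ∑ i, ∑ a, coordMarginal P i a * condMean P i g a ^ 2

theorem coordMarginal_nonneg (hP : ∀ x, 0 ≤ P x) (i : Fin d) (a : X i) :
    0 ≤ coordMarginal P i a :=
  Finset.sum_nonneg fun _ _ => hP _

theorem le_coordMarginal (hP : ∀ x, 0 ≤ P x) (i : Fin d) (x : ∀ i, X i) :
    P x ≤ coordMarginal P i (x i) :=
  Finset.single_le_sum (f := P) (fun _ _ => hP _) (by simp)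

theorem sum_coordMarginal_mul (P : (∀ i, X i) → ℝ) (i : Fin d) (g : X i → ℝ) :
    ∑ a, coordMarginal P i a * g a = ∑ x, P x * g (x i) :=
  sum_fiberwise_mul Finset.univ (fun x : ∀ i, X i => x i) P g

theorem sum_coordMarginal (P : (∀ i, X i) → ℝ) (i : Fin d) :
    ∑ a, coordMarginal P i a = ∑ x, P x := by
  simpa using sum_coordMarginal_mul P i 1

theorem coordMarginal_mem_stdSimplex (hP : P ∈ stdSimplex ℝ (∀ i, X i)) (i : Fin d) :
    coordMarginal P i ∈ stdSimplex ℝ (X i) :=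
  ⟨coordMarginal_nonneg hP.1 i, (sum_coordMarginal P i).trans hP.2⟩

theorem coordMarginal_mul_condMean {i : Fin d} {a : X i} (h : coordMarginal P i a ≠ 0)
    (g : (∀ i, X i) → ℝ) :
    coordMarginal P i a * condMean P i g a = ∑ x with x i = a, P x * g x :=
  mul_div_cancel₀ _ h

theorem condMean_sum_mul {κ : Type*} [Fintype κ] (P : (∀ i, X i) → ℝ) (i : Fin d) (w : κ → ℝ)
    (g : κ → (∀ i, X i) → ℝ) (a : X i) :
    condMean P i (fun x => ∑ k, w k * g k x) a = ∑ k, w k * condMean P i (g k) a := by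
  simp only [condMean, Finset.mul_sum, Finset.sum_div, mul_div_assoc', mul_left_comm (w _)]
  exact Finset.sum_comm

variable {𝒰 : Type*}

/-- The law of `(U, X_i)` under a joint law of `(U, X^d)`. -/
def coordLaw (Q : 𝒰 × (∀ i, X i) → ℝ) (i : Fin d) (z : 𝒰 × X i) : ℝ :=
  ∑ x with x i = z.2, Q (z.1, x)

theorem le_coordLaw {Q : 𝒰 × (∀ i, X i) → ℝ} (hQ : ∀ z, 0 ≤ Q z) (i : Fin d)
    (z : 𝒰 × (∀ i, X i)) : Q z ≤ coordLaw Q i (z.1, z.2 i) :=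
  le_coordMarginal (P := fun x => Q (z.1, x)) (fun _ => hQ _) i z.2

theorem marginalU_coordLaw (Q : 𝒰 × (∀ i, X i) → ℝ) (i : Fin d) (u : 𝒰) :
    marginalU (coordLaw Q i) u = marginalU Q u :=
  sum_coordMarginal (fun x => Q (u, x)) i

theorem marginalX_coordLaw [Fintype 𝒰] (Q : 𝒰 × (∀ i, X i) → ℝ) (i : Fin d) (a : X i) :
    marginalX (coordLaw Q i) a = coordMarginal (marginalX Q) i a := by
  simp only [marginalX, coordLaw, coordMarginal]
  exact Finset.sum_comm

theorem coordMarginal_condX (Q : 𝒰 × (∀ i, X i) → ℝ) (u : 𝒰) (i : Fin d) (a : X i) :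
    coordMarginal (condX Q u) i a = coordLaw Q i (u, a) / marginalU Q u := by
  simp only [coordMarginal, condX, coordLaw, Finset.sum_div]

variable [Fintype 𝒰]

theorem mutualInfo_coordLaw (Q : 𝒰 × (∀ i, X i) → ℝ) (i : Fin d) :
    mutualInfo (coordLaw Q i) = ∑ z, Q z * Real.log (coordLaw Q i (z.1, z.2 i) /
      (marginalU Q z.1 * coordMarginal (marginalX Q) i (z.2 i))) := by
  simp only [mutualInfo, kl, Fintype.sum_prod_type, marginalU_coordLaw, marginalX_coordLaw]
  exact Finset.sum_congr rfl fun u _ =>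
    sum_coordMarginal_mul (fun x => Q (u, x)) i fun a =>
      Real.log (coordLaw Q i (u, a) / (marginalU Q u * coordMarginal (marginalX Q) i a))

theorem totalCorrelation_marginalX (Q : 𝒰 × (∀ i, X i) → ℝ) :
    totalCorrelation (marginalX Q) = ∑ z, Q z * Real.log (marginalX Q z.2 /
      ∏ i, coordMarginal (marginalX Q) i (z.2 i)) :=
  sum_marginalX_mul Q fun x =>
    Real.log (marginalX Q x / ∏ i, coordMarginal (marginalX Q) i (x i))

theorem sum_marginalU_mul_totalCorrelation_condX {Q : 𝒰 × (∀ i, X i) → ℝ} (hQ : ∀ z, 0 ≤ Q z) :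
    ∑ u, marginalU Q u * totalCorrelation (condX Q u) = ∑ z, Q z * Real.log
      (Q z / marginalU Q z.1 / ∏ i, coordLaw Q i (z.1, z.2 i) / marginalU Q z.1) := by
  simp only [totalCorrelation, kl, Finset.mul_sum, Fintype.sum_prod_type, coordMarginal_condX]
  refine Finset.sum_congr rfl fun u _ => Finset.sum_congr rfl fun x _ => ?_
  rcases (marginalU_nonneg hQ u).eq_or_lt with hu | hu
  · have hx : Q (u, x) = 0 := le_antisymm (hu ▸ le_marginalU hQ u x) (hQ _)
    rw [← hu, hx, zero_mul, zero_mul]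
  · rw [← mul_assoc, condX, mul_div_cancel₀ _ hu.ne']

theorem reduction_eq {Q : 𝒰 × (∀ i, X i) → ℝ} (hQ : ∀ z, 0 ≤ Q z) :
    reduction Q = ∑ i, mutualInfo (coordLaw Q i) - mutualInfo Q := by
  simp only [reduction, totalCorrelation_marginalX, sum_marginalU_mul_totalCorrelation_condX hQ,
    mutualInfo_coordLaw]
  rw [mutualInfo, kl, Finset.sum_comm, ← Finset.sum_sub_distrib, ← Finset.sum_sub_distrib]
  refine Finset.sum_congr rfl fun z _ => ?_
  rw [← Finset.mul_sum, ← mul_sub, ← mul_sub]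
  rcases (hQ z).eq_or_lt with hz | hz
  · rw [← hz, zero_mul, zero_mul]
  have hx : 0 < marginalX Q z.2 := hz.trans_le (le_marginalX hQ z.1 z.2)
  rw [log_div_prod_sub_log_div_prod hz.ne' (hz.trans_le (le_marginalU hQ z.1 z.2)).ne' hx.ne'
    (fun i => (hz.trans_le (le_coordLaw hQ i z)).ne')
    fun i => (hx.trans_le (le_coordMarginal (marginalX_nonneg hQ) i z.2)).ne']

variable {ι : Type*} {l : Filter ι} {s : ι → ℝ}

theorem condMean_isBigO {g : ι → (∀ i, X i) → ℝ} (hg : ∀ x, (fun j => g j x) =O[l] s)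
    (i : Fin d) (a : X i) : (fun j => condMean P i (g j) a) =O[l] s := by
  simp only [condMean, div_eq_inv_mul]
  exact (IsBigO.fun_sum fun x _ => (hg x).const_mul_left (P x)).const_mul_left _

theorem condMean_isLittleO {g : ι → (∀ i, X i) → ℝ} (hg : ∀ x, (fun j => g j x) =o[l] s)
    (i : Fin d) (a : X i) : (fun j => condMean P i (g j) a) =o[l] s := by
  simp only [condMean, div_eq_inv_mul]
  exact (IsLittleO.fun_sum fun x _ => (hg x).const_mul_left (P x)).const_mul_left _

theorem energy_sub_isLittleO {f g : ι → (∀ i, X i) → ℝ} (hf : ∀ x, (fun j => f j x) =O[l] s)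
    (hfg : ∀ x, (fun j => f j x - g j x) =o[l] s) :
    (fun j => energy P (f j) - energy P (g j)) =o[l] fun j => s j ^ 2 := by
  have hsub : ∀ i a j, condMean P i (fun x => f j x - g j x) a =
      condMean P i (f j) a - condMean P i (g j) a := fun i a j => by
    simp only [condMean, mul_sub, Finset.sum_sub_distrib, sub_div]
  simp only [energy, ← Finset.sum_sub_distrib, ← mul_sub]
  exact IsLittleO.fun_sum fun i _ => IsLittleO.fun_sum fun a _ => IsLittleO.const_mul_left
    (isLittleO_sq_sub_sq (condMean_isBigO hf i a)
      ((condMean_isLittleO hfg i a).congr_left (hsub i a))) _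

namespace IsPerturbation

variable {a : ι → 𝒰 → ℝ} {Q ε : ι → 𝒰 × (∀ i, X i) → ℝ}

theorem coordLaw (h : IsPerturbation l s a P Q ε) (hpos : ∀ i a, 0 < coordMarginal P i a)
    (i : Fin d) :
    IsPerturbation l s a (coordMarginal P i) (fun j => coordLaw (Q j) i)
      fun j z => condMean P i (fun x => ε j (z.1, x)) z.2 where
  tendsto := h.tendsto
  left_mem := h.left_mem
  right_mem := coordMarginal_mem_stdSimplex h.right_mem i
  eq_mul := by
    filter_upwards [h.eq_mul] with j hj z
    rw [mul_assoc, mul_add, mul_one, coordMarginal_mul_condMean (hpos i _).ne', coordMarginal,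
      TotalCorr.coordLaw, ← Finset.sum_add_distrib, Finset.mul_sum]
    exact Finset.sum_congr rfl fun x _ => by rw [hj]; ring
  sum_eq_one := by
    filter_upwards [h.sum_eq_one] with j hj
    rw [← sum_marginalU, Finset.sum_congr rfl fun u _ => marginalU_coordLaw (Q j) i u,
      sum_marginalU, hj]
  isBigO z := condMean_isBigO (fun x => h.isBigO (z.1, x)) i z.2
  sum_right_isLittleO u := by
    refine (h.sum_right_isLittleO u).congr_left fun j => ?_
    simp only [coordMarginal_mul_condMean (hpos i _).ne']
    exact (Finset.sum_fiberwise Finset.univ (fun x : ∀ i, X i => x i) _).symm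
  sum_left_isLittleO b := by
    simp only [← condMean_sum_mul]
    exact condMean_isLittleO h.sum_left_isLittleO i b

theorem reduction_sub_isLittleO (h : IsPerturbation l s a P Q ε)
    (hpos : ∀ i a, 0 < coordMarginal P i a) :
    (fun j => reduction (Q j) - (∑ u, a j u * energy P (fun x => ε j (u, x)) -
      ∑ z : 𝒰 × (∀ i, X i), a j z.1 * P z.2 * ε j z ^ 2) / 2) =o[l] fun j => s j ^ 2 := by
  have henergy : ∀ j, ∑ u, a j u * energy P (fun x => ε j (u, x)) = ∑ i, ∑ z : 𝒰 × X i,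
      a j z.1 * coordMarginal P i z.2 * condMean P i (fun x => ε j (z.1, x)) z.2 ^ 2 := fun j => by
    simp only [energy, Fintype.sum_prod_type, Finset.mul_sum, mul_assoc]
    exact Finset.sum_comm
  refine ((IsLittleO.fun_sum (s := Finset.univ) fun i _ =>
    (h.coordLaw hpos i).mutualInfo_sub_isLittleO).sub h.mutualInfo_sub_isLittleO).congr' ?_
    EventuallyEq.rfl
  filter_upwards [h.eventually_nonneg] with j hQ
  rw [reduction_eq hQ, henergy, Finset.sum_sub_distrib, ← Finset.sum_div]
  ring

end IsPerturbation

end Coordinates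

section Hermitian

variable {n : Type*} [Fintype n] [DecidableEq n] {M : Matrix n n ℝ} (hM : M.IsHermitian)
include hM

/-- The coordinate of a vector along the `j`-th vector of the orthonormal eigenbasis of a
symmetric matrix. -/
noncomputable def eigenCoord (j : n) (φ : n → ℝ) : ℝ := (hM.eigenvectorBasis j).ofLp ⬝ᵥ φ

theorem sum_eigenCoord_smul (φ : n → ℝ) :
    ∑ j, eigenCoord hM j φ • (hM.eigenvectorBasis j).ofLp = φ := by
  have h := congrArg WithLp.ofLp (hM.eigenvectorBasis.sum_repr' (WithLp.toLp 2 φ))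
  simpa [eigenCoord, EuclideanSpace.inner_eq_star_dotProduct, dotProduct_comm φ] using h

theorem dotProduct_eq_sum_eigenCoord (φ χ : n → ℝ) :
    φ ⬝ᵥ χ = ∑ j, eigenCoord hM j φ * eigenCoord hM j χ := by
  conv_lhs => rw [← sum_eigenCoord_smul hM φ]
  simp only [sum_dotProduct, smul_dotProduct, smul_eq_mul, eigenCoord]

theorem eigenCoord_mulVec (j : n) (φ : n → ℝ) :
    eigenCoord hM j (M *ᵥ φ) = hM.eigenvalues j * eigenCoord hM j φ := by
  have ht : Mᵀ = M := by simpa [conjTranspose_eq_transpose_of_trivial] using hM.eq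
  rw [eigenCoord, dotProduct_mulVec, ← mulVec_transpose, ht, hM.mulVec_eigenvectorBasis,
    smul_dotProduct, smul_eq_mul, eigenCoord]

theorem eigenCoord_eq_zero {v : n → ℝ} {μ : ℝ} (hv : M *ᵥ v = μ • v) {j : n}
    (hj : hM.eigenvalues j ≠ μ) : eigenCoord hM j v = 0 := by
  have h := eigenCoord_mulVec hM j v
  rw [hv, eigenCoord, dotProduct_smul, smul_eq_mul] at h
  exact (mul_eq_mul_right_iff.1 h).resolve_left hj.symm

theorem dotProduct_mulVec_le_of_eigenCoord {c : ℝ} {φ : n → ℝ}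
    (h : ∀ j, c < hM.eigenvalues j → eigenCoord hM j φ = 0) :
    φ ⬝ᵥ M *ᵥ φ ≤ c * (φ ⬝ᵥ φ) := by
  rw [dotProduct_eq_sum_eigenCoord hM, dotProduct_eq_sum_eigenCoord hM φ φ, Finset.mul_sum]
  refine Finset.sum_le_sum fun j _ => ?_
  rw [eigenCoord_mulVec, mul_left_comm]
  rcases lt_or_ge c (hM.eigenvalues j) with hj | hj
  · simp [h j hj]
  · exact mul_le_mul_of_nonneg_right hj (mul_self_nonneg _)

theorem span_eigenvectorBasis_le_span {κ : Type*} [Fintype κ] {v : κ → n → ℝ} {μ : κ → ℝ} {c : ℝ}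
    (hv : LinearIndependent ℝ v) (hμ : ∀ k, M *ᵥ v k = μ k • v k) (hc : ∀ k, c < μ k)
    (hcard : Finset.card {j | c < hM.eigenvalues j} ≤ Fintype.card κ) :
    Submodule.span ℝ ((fun j => (hM.eigenvectorBasis j).ofLp) '' {j | c < hM.eigenvalues j}) ≤
      Submodule.span ℝ (Set.range v) := by
  classical
  set e : n → n → ℝ := fun j => (hM.eigenvectorBasis j).ofLp
  have hle : Submodule.span ℝ (Set.range v) ≤
      Submodule.span ℝ (e '' {j | c < hM.eigenvalues j}) := by
    rw [Submodule.span_le]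
    rintro _ ⟨k, rfl⟩
    rw [← sum_eigenCoord_smul hM (v k)]
    refine Submodule.sum_mem _ fun j _ => ?_
    rcases lt_or_ge c (hM.eigenvalues j) with hj | hj
    · exact Submodule.smul_mem _ _ (Submodule.subset_span ⟨j, hj, rfl⟩)
    · rw [eigenCoord_eq_zero hM (hμ k) (hj.trans_lt (hc k)).ne, zero_smul]
      exact Submodule.zero_mem _
  refine (Submodule.eq_of_le_of_finrank_le hle ?_).ge
  rw [finrank_span_eq_card hv]
  calc Module.finrank ℝ (Submodule.span ℝ (e '' {j | c < hM.eigenvalues j}))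
      = Module.finrank ℝ (Submodule.span ℝ
          (Finset.image e {j | c < hM.eigenvalues j} : Set (n → ℝ))) := by
        rw [Finset.coe_image, Finset.coe_filter_univ]
    _ ≤ (Finset.image e {j | c < hM.eigenvalues j}).card := finrank_span_finset_le_card _
    _ ≤ Finset.card {j | c < hM.eigenvalues j} := Finset.card_image_le
    _ ≤ Fintype.card κ := hcard

theorem dotProduct_mulVec_le_of_orthogonal {κ : Type*} [Fintype κ] {v : κ → n → ℝ} {μ : κ → ℝ}
    {c : ℝ} {φ : n → ℝ} (hv : LinearIndependent ℝ v) (hμ : ∀ k, M *ᵥ v k = μ k • v k)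
    (hc : ∀ k, c < μ k) (hcard : Finset.card {j | c < hM.eigenvalues j} ≤ Fintype.card κ)
    (hφ : ∀ k, v k ⬝ᵥ φ = 0) : φ ⬝ᵥ M *ᵥ φ ≤ c * (φ ⬝ᵥ φ) := by
  refine dotProduct_mulVec_le_of_eigenCoord hM fun j hj => ?_
  have hmem : (hM.eigenvectorBasis j).ofLp ∈ Submodule.span ℝ (Set.range v) :=
    span_eigenvectorBasis_le_span hM hv hμ hc hcard (Submodule.subset_span ⟨j, hj, rfl⟩)
  rw [eigenCoord]
  generalize (hM.eigenvectorBasis j).ofLp = w at hmem ⊢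
  induction hmem using Submodule.span_induction with
  | mem x hx =>
    obtain ⟨k, rfl⟩ := hx
    exact hφ k
  | zero => exact zero_dotProduct φ
  | add x y _ _ hx hy => rw [add_dotProduct, hx, hy, add_zero]
  | smul r x _ hx => rw [smul_dotProduct, hx, smul_zero]

end Hermitian

section Spectrum

variable {d : ℕ} {X : Fin d → Type*} [∀ i, Fintype (X i)] [∀ i, DecidableEq (X i)]
  {P : (∀ i, X i) → ℝ}

/-- The function `∑ i, f_i(x_i)` of `x`, where `f_i` is the feature of `φ`. -/
noncomputable def featureSum (P : (∀ i, X i) → ℝ) (φ : (Σ i, X i) → ℝ) (x : ∀ i, X i) : ℝ :=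
  ∑ i, feature P φ i (x i)

/-- The vector with entries `√P_{X_i}(a) E[g(X^d) | X_i = a]`. As a map from `L²(P)` to Euclidean
space it is the adjoint of `featureSum P`, and `pairwiseMatrix P` is the composition of the two. -/
noncomputable def scaledCondMean (P : (∀ i, X i) → ℝ) (g : (∀ i, X i) → ℝ) : (Σ i, X i) → ℝ :=
  fun p => √(coordMarginal P p.1 p.2) * condMean P p.1 g p.2

theorem scaledCondMean_mul_add (P : (∀ i, X i) → ℝ) (c : ℝ) (f g : (∀ i, X i) → ℝ) :
    scaledCondMean P (fun x => c * f x + g x) =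
      c • scaledCondMean P f + scaledCondMean P g := by
  ext p
  simp only [scaledCondMean, condMean, Pi.add_apply, Pi.smul_apply, smul_eq_mul, mul_add,
    Finset.sum_add_distrib, mul_left_comm _ c, ← Finset.mul_sum, add_div, mul_div_assoc]

theorem energy_eq_dotProduct (hP : ∀ x, 0 ≤ P x) (g : (∀ i, X i) → ℝ) :
    energy P g = scaledCondMean P g ⬝ᵥ scaledCondMean P g := by
  rw [dotProduct, Fintype.sum_sigma]
  refine Finset.sum_congr rfl fun i _ => Finset.sum_congr rfl fun a _ => ?_
  rw [← sq, scaledCondMean, mul_pow, Real.sq_sqrt (coordMarginal_nonneg hP i a)]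

theorem dotProduct_scaledCondMean (hpos : ∀ i a, 0 < coordMarginal P i a) (φ : (Σ i, X i) → ℝ)
    (g : (∀ i, X i) → ℝ) :
    φ ⬝ᵥ scaledCondMean P g = ∑ x, P x * (featureSum P φ x * g x) := by
  have hcoord : ∀ i, ∑ a, φ ⟨i, a⟩ * scaledCondMean P g ⟨i, a⟩ =
      ∑ x, P x * g x * feature P φ i (x i) := fun i => by
    rw [← sum_fiberwise_mul Finset.univ (fun x : ∀ i, X i => x i)]
    refine Finset.sum_congr rfl fun a _ => ?_
    have hs : √(coordMarginal P i a) ≠ 0 := (Real.sqrt_pos.2 (hpos i a)).ne'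
    rw [← coordMarginal_mul_condMean (hpos i a).ne', feature, scaledCondMean]
    nth_rw 2 [← Real.mul_self_sqrt (hpos i a).le]
    field_simp
  rw [dotProduct, Fintype.sum_sigma, Finset.sum_congr rfl fun i _ => hcoord i, Finset.sum_comm]
  refine Finset.sum_congr rfl fun x _ => ?_
  rw [← Finset.mul_sum, featureSum]
  ring

theorem pairMarginal_self (P : (∀ i, X i) → ℝ) (i : Fin d) (a b : X i) :
    pairMarginal P i i a b = if a = b then coordMarginal P i a else 0 := by
  split_ifs with hab
  · simp only [pairMarginal, coordMarginal, ← hab, and_self]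
  · exact Finset.sum_eq_zero fun x hx =>
      absurd ((Finset.mem_filter.1 hx).2.1.symm.trans (Finset.mem_filter.1 hx).2.2) hab

theorem sum_pairMarginal_mul (P : (∀ i, X i) → ℝ) (i j : Fin d) (a : X i) (g : X j → ℝ) :
    ∑ b, pairMarginal P i j a b * g b = ∑ x with x i = a, P x * g (x j) := by
  rw [← sum_fiberwise_mul _ fun x : ∀ i, X i => x j]
  simp only [pairMarginal, Finset.filter_filter]

theorem pairwiseMatrix_apply (hpos : ∀ i a, 0 < coordMarginal P i a) (p q : Σ i, X i) :
    pairwiseMatrix P p q = pairMarginal P p.1 q.1 p.2 q.2 /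
      (√(coordMarginal P p.1 p.2) * √(coordMarginal P q.1 q.2)) := by
  obtain ⟨i, a⟩ := p
  obtain ⟨j, b⟩ := q
  rw [pairwiseMatrix, of_apply]
  split_ifs with hij hab
  · cases hab
    rw [pairMarginal_self, if_pos rfl, Real.mul_self_sqrt (hpos i a).le, div_self (hpos i a).ne']
  · cases hij
    rw [pairMarginal_self, if_neg fun h => hab (congrArg _ h), zero_div]
  · rfl

theorem pairwiseMatrix_mulVec (hpos : ∀ i a, 0 < coordMarginal P i a) (φ : (Σ i, X i) → ℝ) :
    pairwiseMatrix P *ᵥ φ = scaledCondMean P (featureSum P φ) := by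
  ext ⟨i, a⟩
  have hterm : ∀ j b, pairwiseMatrix P ⟨i, a⟩ ⟨j, b⟩ * φ ⟨j, b⟩ =
      (√(coordMarginal P i a))⁻¹ * (pairMarginal P i j a b * feature P φ j b) := fun j b => by
    rw [pairwiseMatrix_apply hpos, feature]
    ring
  have hs : √(coordMarginal P i a) ≠ 0 := (Real.sqrt_pos.2 (hpos i a)).ne'
  simp only [mulVec, dotProduct, Fintype.sum_sigma, hterm, ← Finset.mul_sum, sum_pairMarginal_mul]
  rw [Finset.sum_comm, scaledCondMean, condMean]
  simp only [← Finset.mul_sum, featureSum]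
  nth_rw 3 [← Real.mul_self_sqrt (hpos i a).le]
  field_simp

theorem dotProduct_pairwiseMatrix_mulVec (hpos : ∀ i a, 0 < coordMarginal P i a)
    (φ χ : (Σ i, X i) → ℝ) :
    φ ⬝ᵥ pairwiseMatrix P *ᵥ χ = ∑ x, P x * (featureSum P φ x * featureSum P χ x) := by
  rw [pairwiseMatrix_mulVec hpos, dotProduct_scaledCondMean hpos]

theorem sum_mul_sum_feature_sq (hpos : ∀ i a, 0 < coordMarginal P i a) (φ : (Σ i, X i) → ℝ) :
    ∑ x, P x * ∑ i, feature P φ i (x i) ^ 2 = φ ⬝ᵥ φ := by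
  simp only [Finset.mul_sum, dotProduct, Fintype.sum_sigma]
  rw [Finset.sum_comm]
  refine Finset.sum_congr rfl fun i _ => ?_
  rw [← sum_coordMarginal_mul P i fun a => feature P φ i a ^ 2]
  refine Finset.sum_congr rfl fun a _ => ?_
  rw [feature, div_pow, Real.sq_sqrt (hpos i a).le, mul_div_cancel₀ _ (hpos i a).ne', sq]

theorem dotProduct_pairwiseMatrix_mulVec_le (hP : ∀ x, 0 ≤ P x)
    (hpos : ∀ i a, 0 < coordMarginal P i a) (φ : (Σ i, X i) → ℝ) :
    φ ⬝ᵥ pairwiseMatrix P *ᵥ φ ≤ d * (φ ⬝ᵥ φ) := by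
  rw [dotProduct_pairwiseMatrix_mulVec hpos, ← sum_mul_sum_feature_sq hpos, Finset.mul_sum]
  refine Finset.sum_le_sum fun x _ => ?_
  rw [← sq, mul_left_comm]
  have hcs := sq_sum_le_card_mul_sum_sq (s := Finset.univ) (f := fun i => feature P φ i (x i))
  rw [Finset.card_univ, Fintype.card_fin] at hcs
  exact mul_le_mul_of_nonneg_left hcs (hP x)

theorem featureSum_psiZero (hpos : ∀ i a, 0 < coordMarginal P i a) (x : ∀ i, X i) :
    featureSum P (psiZero P) x = √d := by
  have hfeature : ∀ i, feature P (psiZero P) i (x i) = (√d)⁻¹ := fun i =>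
    mul_div_cancel_right₀ _ (Real.sqrt_pos.2 (hpos i (x i))).ne'
  simp only [featureSum, hfeature, Finset.sum_const, Finset.card_univ, Fintype.card_fin,
    nsmul_eq_mul]
  exact Real.div_sqrt

theorem pairwiseMatrix_mulVec_psiZero (hpos : ∀ i a, 0 < coordMarginal P i a) :
    pairwiseMatrix P *ᵥ psiZero P = (d : ℝ) • psiZero P := by
  ext ⟨i, a⟩
  rw [pairwiseMatrix_mulVec hpos, scaledCondMean, condMean]
  simp only [featureSum_psiZero hpos, ← Finset.sum_mul]
  rw [← coordMarginal, mul_div_right_comm, div_self (hpos i a).ne', Pi.smul_apply, psiZero,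
    smul_eq_mul, ← mul_assoc (d : ℝ), ← div_eq_mul_inv, Real.div_sqrt]
  ring

theorem psiZero_dotProduct_scaledCondMean (hpos : ∀ i a, 0 < coordMarginal P i a)
    {g : (∀ i, X i) → ℝ} (hg : ∑ x, P x * g x = 0) : psiZero P ⬝ᵥ scaledCondMean P g = 0 := by
  simp only [dotProduct_scaledCondMean hpos, featureSum_psiZero hpos, mul_left_comm _ √(d : ℝ),
    ← Finset.mul_sum, hg, mul_zero]

theorem psiZero_ne_zero (hP : P ∈ stdSimplex ℝ (∀ i, X i))
    (hpos : ∀ i a, 0 < coordMarginal P i a) (hd : d ≠ 0) : psiZero P ≠ 0 := by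
  intro h
  obtain ⟨x, -⟩ := Finset.nonempty_of_sum_ne_zero (hP.2.trans_ne one_ne_zero)
  have hx := featureSum_psiZero hpos x
  simp only [h, featureSum, feature, Pi.zero_apply, zero_div, Finset.sum_const_zero] at hx
  exact (Real.sqrt_pos.2 (Nat.cast_pos.2 hd.bot_lt)).ne hx

theorem card_lt_eigenvalues_le {k : ℕ} {c : ℝ} (h : eig P k ≤ c) :
    Finset.card {j | c < (pairwiseMatrix_isHermitian P).eigenvalues j} ≤ k := by
  let index : (Σ i, X i) ≃ Fin (Fintype.card (Σ i, X i)) :=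
    (Fintype.equivOfCardEq (Fintype.card_fin _)).symm
  rw [← Finset.card_range k]
  refine Finset.card_le_card_of_injOn (fun j => (index j : ℕ)) (fun j hj => ?_)
    (Fin.val_injective.comp index.injective).injOn
  rw [Finset.coe_range, Set.mem_Iio]
  by_contra! hk
  refine (Finset.mem_filter.1 hj).2.not_ge (le_trans ?_ h)
  rw [eig, dif_pos (hk.trans_lt (index j).2)]
  exact (pairwiseMatrix_isHermitian P).eigenvalues₀_antitone (Fin.mk_le_of_le_val hk)

theorem dotProduct_pairwiseMatrix_mulVec_le_eig_one (hP : P ∈ stdSimplex ℝ (∀ i, X i))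
    (hpos : ∀ i a, 0 < coordMarginal P i a) {φ : (Σ i, X i) → ℝ} (hφ : psiZero P ⬝ᵥ φ = 0) :
    φ ⬝ᵥ pairwiseMatrix P *ᵥ φ ≤ eig P 1 * (φ ⬝ᵥ φ) := by
  rcases eq_or_ne d 0 with rfl | hd
  · simp [dotProduct]
  rcases le_or_gt (d : ℝ) (eig P 1) with h | h
  · exact (dotProduct_pairwiseMatrix_mulVec_le hP.1 hpos φ).trans
      (mul_le_mul_of_nonneg_right h (Finset.sum_nonneg fun _ _ => mul_self_nonneg _))
  · exact dotProduct_mulVec_le_of_orthogonal (pairwiseMatrix_isHermitian P)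
      (v := fun _ : Unit => psiZero P)
      (linearIndependent_unique_iff.2 (psiZero_ne_zero hP hpos hd))
      (fun _ => pairwiseMatrix_mulVec_psiZero hpos) (fun _ => h)
      (card_lt_eigenvalues_le le_rfl) fun _ => hφ

theorem one_le_eig_one (hP : P ∈ stdSimplex ℝ (∀ i, X i))
    (hpos : ∀ i a, 0 < coordMarginal P i a) (hX : ∃ i, Nontrivial (X i)) : 1 ≤ eig P 1 := by
  obtain ⟨i, hi⟩ := hX
  obtain ⟨a, b, hab⟩ := hi.exists_pair_ne
  have hne : (⟨i, a⟩ : Σ i, X i) ≠ ⟨i, b⟩ := fun h => hab (by simpa using h)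
  set α := √(coordMarginal P i a)
  set β := √(coordMarginal P i b)
  set φ : (Σ i, X i) → ℝ := Pi.single ⟨i, a⟩ β - Pi.single ⟨i, b⟩ α
  have horth : psiZero P ⬝ᵥ φ = 0 := by
    rw [dotProduct_sub, dotProduct_single, dotProduct_single, psiZero, psiZero]
    ring
  have hnorm : φ ⬝ᵥ φ = α ^ 2 + β ^ 2 := by
    simp only [φ, sub_dotProduct, single_dotProduct, Pi.sub_apply, Pi.single_eq_same,
      Pi.single_eq_of_ne hne, Pi.single_eq_of_ne hne.symm]
    ring
  have hform : φ ⬝ᵥ pairwiseMatrix P *ᵥ φ = α ^ 2 + β ^ 2 := by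
    simp only [φ, mulVec_sub, sub_dotProduct, dotProduct_sub, single_dotProduct, mulVec_single,
      Pi.smul_apply, col_apply, pairwiseMatrix, of_apply, if_true, hne, hne.symm, if_false,
      MulOpposite.smul_eq_mul_unop, MulOpposite.unop_op]
    ring
  have hpos' : 0 < α ^ 2 + β ^ 2 :=
    add_pos (pow_pos (Real.sqrt_pos.2 (hpos i a)) 2) (pow_pos (Real.sqrt_pos.2 (hpos i b)) 2)
  have h := dotProduct_pairwiseMatrix_mulVec_le_eig_one hP hpos horth
  rw [hnorm, hform] at h
  exact (le_mul_iff_one_le_left hpos').1 h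

theorem energy_le_of_dotProduct_le (hP : ∀ x, 0 ≤ P x) (hpos : ∀ i a, 0 < coordMarginal P i a)
    {g : (∀ i, X i) → ℝ} {κ : ℝ} (hκ : 0 ≤ κ)
    (h : scaledCondMean P g ⬝ᵥ pairwiseMatrix P *ᵥ scaledCondMean P g ≤
      κ * (scaledCondMean P g ⬝ᵥ scaledCondMean P g)) :
    energy P g ≤ κ * ∑ x, P x * g x ^ 2 := by
  set F := featureSum P (scaledCondMean P g)
  set E := energy P g with hE
  rw [dotProduct_pairwiseMatrix_mulVec hpos, ← energy_eq_dotProduct hP, ← hE] at h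
  have hEF : E = ∑ x, P x * (F x * g x) := by
    rw [hE, energy_eq_dotProduct hP, dotProduct_scaledCondMean hpos]
  have hG : 0 ≤ ∑ x, P x * g x ^ 2 := Finset.sum_nonneg fun x _ => mul_nonneg (hP x) (sq_nonneg _)
  have hcs : E ^ 2 ≤ (∑ x, P x * (F x * F x)) * ∑ x, P x * g x ^ 2 := by
    rw [hEF]
    exact Finset.sum_sq_le_sum_mul_sum_of_sq_le_mul _
      (fun x _ => mul_nonneg (hP x) (mul_self_nonneg _))
      (fun x _ => mul_nonneg (hP x) (sq_nonneg _)) fun x _ => le_of_eq (by ring)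
  rcases le_or_gt E 0 with hE0 | hE0
  · exact hE0.trans (mul_nonneg hκ hG)
  · refine le_of_mul_le_mul_right ?_ hE0
    calc E * E = E ^ 2 := (sq E).symm
      _ ≤ κ * E * ∑ x, P x * g x ^ 2 := hcs.trans (mul_le_mul_of_nonneg_right h hG)
      _ = κ * (∑ x, P x * g x ^ 2) * E := mul_right_comm _ _ _

theorem energy_le_eig_one (hP : P ∈ stdSimplex ℝ (∀ i, X i))
    (hpos : ∀ i a, 0 < coordMarginal P i a) (hX : ∃ i, Nontrivial (X i)) {g : (∀ i, X i) → ℝ}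
    (hg : ∑ x, P x * g x = 0) : energy P g ≤ eig P 1 * ∑ x, P x * g x ^ 2 :=
  energy_le_of_dotProduct_le hP.1 hpos (zero_le_one.trans (one_le_eig_one hP hpos hX))
    (dotProduct_pairwiseMatrix_mulVec_le_eig_one hP hpos
      (psiZero_dotProduct_scaledCondMean hpos hg))

namespace IsSecondEigenvector

variable {ψ : (Σ i, X i) → ℝ}

theorem dotProduct_self (hψ : IsSecondEigenvector P ψ) : ψ ⬝ᵥ ψ = 1 := by
  simpa only [dotProduct, ← sq] using hψ.unit

theorem dimension_ne_zero (hψ : IsSecondEigenvector P ψ) : d ≠ 0 := by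
  rintro rfl
  simpa using hψ.unit

theorem sum_featureSum_eq_zero (hψ : IsSecondEigenvector P ψ)
    (hpos : ∀ i a, 0 < coordMarginal P i a) : ∑ x, P x * featureSum P ψ x = 0 := by
  have h : ψ ⬝ᵥ pairwiseMatrix P *ᵥ psiZero P = 0 := by
    rw [pairwiseMatrix_mulVec_psiZero hpos, dotProduct_smul, dotProduct_comm]
    exact (congrArg _ hψ.orthogonal).trans (smul_zero _)
  simp only [dotProduct_pairwiseMatrix_mulVec hpos, featureSum_psiZero hpos, ← mul_assoc,
    ← Finset.sum_mul] at h
  exact (mul_eq_zero.1 h).resolve_right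
    (Real.sqrt_pos.2 (Nat.cast_pos.2 hψ.dimension_ne_zero.bot_lt)).ne'

theorem sum_featureSum_sq (hψ : IsSecondEigenvector P ψ)
    (hpos : ∀ i a, 0 < coordMarginal P i a) : ∑ x, P x * featureSum P ψ x ^ 2 = eig P 1 := by
  simp only [sq]
  rw [← dotProduct_pairwiseMatrix_mulVec hpos, hψ.eigen, dotProduct_smul, hψ.dotProduct_self,
    smul_eq_mul, mul_one]

theorem energy_mul_featureSum_add (hψ : IsSecondEigenvector P ψ) (hP : ∀ x, 0 ≤ P x)
    (hpos : ∀ i a, 0 < coordMarginal P i a) (c : ℝ) {g : (∀ i, X i) → ℝ}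
    (hg : ∑ x, P x * (featureSum P ψ x * g x) = 0) :
    energy P (fun x => c * featureSum P ψ x + g x) = c ^ 2 * eig P 1 ^ 2 + energy P g := by
  have hcross : ψ ⬝ᵥ scaledCondMean P g = 0 := (dotProduct_scaledCondMean hpos ψ g).trans hg
  rw [energy_eq_dotProduct hP, energy_eq_dotProduct hP, scaledCondMean_mul_add,
    ← pairwiseMatrix_mulVec hpos, hψ.eigen]
  simp only [add_dotProduct, dotProduct_add, smul_dotProduct, dotProduct_smul,
    hψ.dotProduct_self, dotProduct_comm _ ψ, hcross, smul_eq_mul]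
  ring

theorem linearIndependent_psiZero (hψ : IsSecondEigenvector P ψ)
    (hP : P ∈ stdSimplex ℝ (∀ i, X i)) (hpos : ∀ i a, 0 < coordMarginal P i a) :
    LinearIndependent ℝ ![psiZero P, ψ] := by
  have hne : psiZero P ≠ 0 := psiZero_ne_zero hP hpos hψ.dimension_ne_zero
  have horth : ψ ⬝ᵥ psiZero P = 0 := (dotProduct_comm _ _).trans hψ.orthogonal
  rw [LinearIndependent.pair_iff]
  intro s t hst
  have ht : t = 0 := by
    simpa [dotProduct_add, horth, hψ.dotProduct_self] using congrArg (ψ ⬝ᵥ ·) hst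
  rw [ht, zero_smul, add_zero] at hst
  exact ⟨(smul_eq_zero.1 hst).resolve_right hne, ht⟩

theorem eig_one_le (hψ : IsSecondEigenvector P ψ) (hP : ∀ x, 0 ≤ P x)
    (hpos : ∀ i a, 0 < coordMarginal P i a) : eig P 1 ≤ d := by
  have h := dotProduct_pairwiseMatrix_mulVec_le hP hpos ψ
  rwa [hψ.eigen, dotProduct_smul, hψ.dotProduct_self, smul_eq_mul, mul_one, mul_one] at h

theorem energy_le (hψ : IsSecondEigenvector P ψ) (hP : P ∈ stdSimplex ℝ (∀ i, X i))
    (hpos : ∀ i a, 0 < coordMarginal P i a) {κ : ℝ} (hκ : 0 ≤ κ) (h2 : eig P 2 ≤ κ)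
    (h1 : κ < eig P 1) {g : (∀ i, X i) → ℝ} (hg : ∑ x, P x * g x = 0)
    (hg' : ∑ x, P x * (featureSum P ψ x * g x) = 0) :
    energy P g ≤ κ * ∑ x, P x * g x ^ 2 := by
  refine energy_le_of_dotProduct_le hP.1 hpos hκ ?_
  refine dotProduct_mulVec_le_of_orthogonal (pairwiseMatrix_isHermitian P)
    (μ := ![(d : ℝ), eig P 1]) (hψ.linearIndependent_psiZero hP hpos) ?_ ?_
    ((card_lt_eigenvalues_le h2).trans_eq (Fintype.card_fin 2).symm) ?_
  · exact Fin.forall_fin_two.2 ⟨pairwiseMatrix_mulVec_psiZero hpos, hψ.eigen⟩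
  · exact Fin.forall_fin_two.2 ⟨h1.trans_le (hψ.eig_one_le hP.1 hpos), h1⟩
  · exact Fin.forall_fin_two.2 ⟨psiZero_dotProduct_scaledCondMean hpos hg,
      (dotProduct_scaledCondMean hpos ψ g).trans hg'⟩

end IsSecondEigenvector

end Spectrum

section Tilt

variable {d : ℕ} {X : Fin d → Type*} [∀ i, Fintype (X i)] [∀ i, DecidableEq (X i)]
  {P : (∀ i, X i) → ℝ} {ψ : (Σ i, X i) → ℝ} {𝒰 : Type*}

/-- The exponent `h(u) / √λ^{(1)} ∑ i, f_i(x_i)` of the exponential family, without its factor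
`√(2δ)`. -/
noncomputable def tilt (P : (∀ i, X i) → ℝ) (ψ : (Σ i, X i) → ℝ) (h : 𝒰 → ℝ)
    (z : 𝒰 × (∀ i, X i)) : ℝ :=
  h z.1 / √(eig P 1) * featureSum P ψ z.2

theorem expWeight_eq_mul_exp_tilt (PU : 𝒰 → ℝ) (δ : ℝ) (h : 𝒰 → ℝ) (z : 𝒰 × (∀ i, X i)) :
    expWeight P ψ PU δ h z = PU z.1 * P z.2 * Real.exp (√(2 * δ) * tilt P ψ h z) := by
  rw [expWeight, mul_assoc √(2 * δ), tilt, featureSum]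

theorem sum_mul_tilt_right (hψ : IsSecondEigenvector P ψ) (hpos : ∀ i a, 0 < coordMarginal P i a)
    (h : 𝒰 → ℝ) (u : 𝒰) : ∑ x, P x * tilt P ψ h (u, x) = 0 := by
  simp only [tilt, mul_left_comm (P _), ← Finset.mul_sum, hψ.sum_featureSum_eq_zero hpos, mul_zero]

theorem mul_tilt_isBigO {ι : Type*} {l : Filter ι} {s : ι → ℝ} {h : ι → 𝒰 → ℝ}
    (hh : ∀ u, (fun i => h i u) =O[l] fun _ => (1 : ℝ))
    (z : 𝒰 × (∀ i, X i)) : (fun i => s i * tilt P ψ (h i) z) =O[l] s := by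
  refine (((isBigO_refl s l).mul (hh z.1)).const_mul_left
    (featureSum P ψ z.2 / √(eig P 1))).congr (fun i => ?_) fun i => mul_one _
  rw [tilt]
  ring

variable [Fintype 𝒰] {PU h : 𝒰 → ℝ}

theorem sum_mul_tilt_left (hh : h ∈ unitFunctions PU) (x : ∀ i, X i) :
    ∑ u, PU u * tilt P ψ h (u, x) = 0 := by
  simp only [tilt, ← mul_assoc, ← mul_div_assoc, ← Finset.sum_mul, ← Finset.sum_div, hh.1,
    zero_div, zero_mul]

theorem sum_mul_tilt (hh : h ∈ unitFunctions PU) :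
    ∑ z : 𝒰 × (∀ i, X i), PU z.1 * P z.2 * tilt P ψ h z = 0 := by
  rw [Fintype.sum_prod_type_right]
  refine Finset.sum_eq_zero fun x _ => ?_
  calc ∑ u, PU u * P x * tilt P ψ h (u, x) = P x * ∑ u, PU u * tilt P ψ h (u, x) := by
        rw [Finset.mul_sum]
        exact Finset.sum_congr rfl fun u _ => by ring
    _ = 0 := by rw [sum_mul_tilt_left hh, mul_zero]

theorem sum_mul_tilt_sq (hψ : IsSecondEigenvector P ψ) (hpos : ∀ i a, 0 < coordMarginal P i a)
    (hev : 0 < eig P 1) (hh : h ∈ unitFunctions PU) (c : ℝ) :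
    ∑ z : 𝒰 × (∀ i, X i), PU z.1 * P z.2 * (c * tilt P ψ h z) ^ 2 = c ^ 2 := by
  have hterm : ∀ u x, PU u * P x * (c * tilt P ψ h (u, x)) ^ 2 =
      c ^ 2 / eig P 1 * (PU u * h u ^ 2) * (P x * featureSum P ψ x ^ 2) := fun u x => by
    rw [tilt, mul_pow, mul_pow, div_pow, Real.sq_sqrt hev.le]
    ring
  simp only [Fintype.sum_prod_type, hterm, ← Finset.mul_sum, ← Finset.sum_mul,
    hψ.sum_featureSum_sq hpos, hh.2, mul_one]
  exact div_mul_cancel₀ _ hev.ne'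

theorem sum_mul_energy_tilt (hψ : IsSecondEigenvector P ψ) (hP : ∀ x, 0 ≤ P x)
    (hpos : ∀ i a, 0 < coordMarginal P i a) (hev : 0 < eig P 1) (hh : h ∈ unitFunctions PU)
    (c : ℝ) : ∑ u, PU u * energy P (fun x => c * tilt P ψ h (u, x)) = c ^ 2 * eig P 1 := by
  have hterm : ∀ u, energy P (fun x => c * tilt P ψ h (u, x)) = c ^ 2 * eig P 1 * h u ^ 2 :=
    fun u => by
      have hu := hψ.energy_mul_featureSum_add hP hpos (c * (h u / √(eig P 1)))
        (g := fun _ => 0) (by simp only [mul_zero, Finset.sum_const_zero])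
      have hzero : energy P (fun _ => 0) = 0 := by simp [energy, condMean]
      simp only [add_zero, hzero, mul_assoc c, mul_pow, div_pow, Real.sq_sqrt hev.le] at hu
      simp only [tilt, hu]
      field_simp
  simp only [hterm, mul_left_comm (PU _), ← Finset.mul_sum, hh.2, mul_one]

theorem unitFunctions_nonempty [Nontrivial 𝒰] (hPU : PU ∈ stdSimplex ℝ 𝒰) (hpos : ∀ u, 0 < PU u) :
    (unitFunctions PU).Nonempty := by
  classical
  obtain ⟨a, b, hab⟩ := exists_pair_ne 𝒰
  have ha : PU a < 1 := hPU.2 ▸ Finset.single_lt_sum hab.symm (Finset.mem_univ a)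
    (Finset.mem_univ b) (hpos b) fun u _ _ => (hpos u).le
  have hvar : 0 < PU a * (1 - PU a) := mul_pos (hpos a) (sub_pos.2 ha)
  have hmean : ∑ u, PU u * Pi.single (M := fun _ => ℝ) a 1 u = PU a := by
    simp [Pi.single_apply]
  refine ⟨fun u => (Pi.single (M := fun _ => ℝ) a 1 u - PU a) / √(PU a * (1 - PU a)), ?_, ?_⟩
  · simp only [mul_div_assoc', ← Finset.sum_div, mul_sub, Finset.sum_sub_distrib, hmean,
      ← Finset.sum_mul, hPU.2, one_mul, sub_self, zero_div]
  · have hterm : ∀ u, PU u * (Pi.single (M := fun _ => ℝ) a 1 u - PU a) ^ 2 =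
        (1 - 2 * PU a) * (PU u * Pi.single (M := fun _ => ℝ) a 1 u) + PU u * PU a ^ 2 :=
      fun u => by
        rcases eq_or_ne u a with rfl | hu
        · simp only [Pi.single_eq_same]
          ring
        · simp [hu]
    simp only [div_pow, Real.sq_sqrt hvar.le, mul_div_assoc', ← Finset.sum_div, hterm,
      Finset.sum_add_distrib, ← Finset.mul_sum, hmean, ← Finset.sum_mul, hPU.2]
    rw [div_eq_one_iff_eq hvar.ne']
    ring

variable {ι : Type*} {l : Filter ι} {s : ι → ℝ} {a h : ι → 𝒰 → ℝ} {Q ε : ι → 𝒰 × (∀ i, X i) → ℝ}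

theorem unitFunctions_isBigO_one {γ : ℝ} (hγ : 0 < γ) (ha : ∀ᶠ i in l, ∀ u, γ < a i u)
    (hh : ∀ᶠ i in l, h i ∈ unitFunctions (a i)) (u : 𝒰) :
    (fun i => h i u) =O[l] fun _ => (1 : ℝ) := by
  refine IsBigO.of_bound √(γ⁻¹) ?_
  filter_upwards [ha, hh] with i hai hhi
  rw [norm_one, mul_one, Real.norm_eq_abs]
  refine Real.abs_le_sqrt ((le_inv_mul_iff₀ hγ).2 ?_ |>.trans_eq (mul_one _))
  calc γ * h i u ^ 2 ≤ a i u * h i u ^ 2 := mul_le_mul_of_nonneg_right (hai u).le (sq_nonneg _)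
    _ ≤ ∑ u, a i u * h i u ^ 2 := Finset.single_le_sum (f := fun u => a i u * h i u ^ 2)
        (fun v _ => mul_nonneg (hγ.trans (hai v)).le (sq_nonneg _)) (Finset.mem_univ u)
    _ = 1 := hhi.2

/-- `Q i` is a law of `(U, X^d)` of the form `a i ⊗ P · (1 + ε i)` with `ε = s · tilt + o(s)`. The
members of the exponential family are of this form, with `s = √(2δ)`, and all the laws of this
form with the same `a`, `h` and `s` agree to the order of approximation of the theorem. -/
structure IsTilted (l : Filter ι) (s : ι → ℝ) (P : (∀ i, X i) → ℝ) (ψ : (Σ i, X i) → ℝ)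
    (a h : ι → 𝒰 → ℝ) (Q ε : ι → 𝒰 × (∀ i, X i) → ℝ) : Prop where
  tendsto : Tendsto s l (𝓝 0)
  left_mem : ∀ᶠ i in l, a i ∈ stdSimplex ℝ 𝒰
  right_mem : P ∈ stdSimplex ℝ (∀ i, X i)
  mem_unitFunctions : ∀ᶠ i in l, h i ∈ unitFunctions (a i)
  isBigO_one : ∀ u, (fun i => h i u) =O[l] fun _ => (1 : ℝ)
  eq_mul : ∀ᶠ i in l, ∀ z, Q i z = a i z.1 * P z.2 * (1 + ε i z)
  sum_eq_one : ∀ᶠ i in l, ∑ z, Q i z = 1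
  sub_isLittleO : ∀ z, (fun i => ε i z - s i * tilt P ψ (h i) z) =o[l] s

namespace IsTilted

theorem isBigO (H : IsTilted l s P ψ a h Q ε) (z : 𝒰 × (∀ i, X i)) :
    (fun i => ε i z) =O[l] s :=
  ((H.sub_isLittleO z).isBigO.add (mul_tilt_isBigO H.isBigO_one z)).congr_left
    fun _ => sub_add_cancel _ _

theorem isPerturbation (H : IsTilted l s P ψ a h Q ε) (hψ : IsSecondEigenvector P ψ)
    (hpos : ∀ i a, 0 < coordMarginal P i a) : IsPerturbation l s a P Q ε where
  tendsto := H.tendsto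
  left_mem := H.left_mem
  right_mem := H.right_mem
  eq_mul := H.eq_mul
  sum_eq_one := H.sum_eq_one
  isBigO := H.isBigO
  sum_right_isLittleO u := by
    refine (IsLittleO.fun_sum (s := Finset.univ) fun x _ =>
      (H.sub_isLittleO (u, x)).const_mul_left (P x)).congr_left fun i => ?_
    simp only [mul_sub, Finset.sum_sub_distrib, mul_left_comm _ (s i), ← Finset.mul_sum,
      sum_mul_tilt_right hψ hpos, mul_zero, sub_zero]
  sum_left_isLittleO x := by
    refine (isLittleO_sum_mul H.left_mem fun u => H.sub_isLittleO (u, x)).congr' ?_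
      EventuallyEq.rfl
    filter_upwards [H.mem_unitFunctions] with i hi
    simp only [mul_sub, Finset.sum_sub_distrib, mul_left_comm _ (s i), ← Finset.mul_sum,
      sum_mul_tilt_left hi, mul_zero, sub_zero]

theorem sum_mul_sq_sub_isLittleO (H : IsTilted l s P ψ a h Q ε) (hψ : IsSecondEigenvector P ψ)
    (hpos : ∀ i a, 0 < coordMarginal P i a) (hev : 0 < eig P 1) :
    (fun i => ∑ z : 𝒰 × (∀ i, X i), a i z.1 * P z.2 * ε i z ^ 2 - s i ^ 2)
      =o[l] fun i => s i ^ 2 := by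
  refine (isLittleO_sum_mul (H.left_mem.mono fun i hi => prod_mem_stdSimplex hi H.right_mem)
    fun z => isLittleO_sq_sub_sq (H.isBigO z) (H.sub_isLittleO z)).congr' ?_ EventuallyEq.rfl
  filter_upwards [H.mem_unitFunctions] with i hi
  simp only [mul_sub, Finset.sum_sub_distrib, sum_mul_tilt_sq hψ hpos hev hi]

theorem sum_mul_energy_sub_isLittleO (H : IsTilted l s P ψ a h Q ε)
    (hψ : IsSecondEigenvector P ψ) (hpos : ∀ i a, 0 < coordMarginal P i a) (hev : 0 < eig P 1) :
    (fun i => ∑ u, a i u * energy P (fun x => ε i (u, x)) - s i ^ 2 * eig P 1)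
      =o[l] fun i => s i ^ 2 := by
  refine (isLittleO_sum_mul H.left_mem fun u => energy_sub_isLittleO (P := P)
    (fun x => H.isBigO (u, x)) fun x => H.sub_isLittleO (u, x)).congr' ?_ EventuallyEq.rfl
  filter_upwards [H.mem_unitFunctions] with i hi
  simp only [mul_sub, Finset.sum_sub_distrib,
    sum_mul_energy_tilt hψ H.right_mem.1 hpos hev hi]

theorem mutualInfo_sub_isLittleO (H : IsTilted l s P ψ a h Q ε) (hψ : IsSecondEigenvector P ψ)
    (hpos : ∀ i a, 0 < coordMarginal P i a) (hev : 0 < eig P 1) :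
    (fun i => mutualInfo (Q i) - s i ^ 2 / 2) =o[l] fun i => s i ^ 2 :=
  ((H.isPerturbation hψ hpos).mutualInfo_sub_isLittleO.add
    ((H.sum_mul_sq_sub_isLittleO hψ hpos hev).const_mul_left (1 / 2))).congr_left
    fun i => by ring

theorem reduction_sub_isLittleO (H : IsTilted l s P ψ a h Q ε) (hψ : IsSecondEigenvector P ψ)
    (hpos : ∀ i a, 0 < coordMarginal P i a) (hev : 0 < eig P 1) :
    (fun i => reduction (Q i) - s i ^ 2 / 2 * (eig P 1 - 1)) =o[l] fun i => s i ^ 2 :=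
  ((H.isPerturbation hψ hpos).reduction_sub_isLittleO hpos |>.add
    (((H.sum_mul_energy_sub_isLittleO hψ hpos hev).sub
      (H.sum_mul_sq_sub_isLittleO hψ hpos hev)).const_mul_left (1 / 2))).congr_left
    fun i => by ring

theorem law_sub_isLittleO (H : IsTilted l s P ψ a h Q ε) (z : 𝒰 × (∀ i, X i)) :
    (fun i => Q i z - a i z.1 * P z.2 * (1 + s i * tilt P ψ (h i) z)) =o[l] s := by
  refine (((isBigO_one_of_mem_stdSimplex H.left_mem z.1).mul_isLittleO
    (H.sub_isLittleO z)).const_mul_left (P z.2)).congr' ?_ (.of_forall fun i => one_mul _)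
  filter_upwards [H.eq_mul] with i hi
  rw [hi]
  ring

end IsTilted

end Tilt

section Exponential

theorem exp_sub_one_sub_isBigO : (fun t : ℝ => Real.exp t - 1 - t) =O[𝓝 0] fun t => t ^ 2 :=
  (Real.exp_sub_sum_range_isBigO_pow 2).congr_left fun t => by
    norm_num [Finset.sum_range_succ]
    ring

variable {ι : Type*} {l : Filter ι}

theorem inv_sum_mul_exp_mul_exp_sub_isBigO {α : Type*} [Fintype α] {s : ι → ℝ} {w t : ι → α → ℝ}
    (hs : Tendsto s l (𝓝 0)) (hw : ∀ᶠ i in l, w i ∈ stdSimplex ℝ α)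
    (hsum : ∀ᶠ i in l, ∑ a, w i a * t i a = 0) (ht : ∀ a, (fun i => t i a) =O[l] s) (a : α) :
    (fun i => (∑ b, w i b * Real.exp (t i b))⁻¹ * Real.exp (t i a) - 1 - t i a)
      =O[l] fun i => s i ^ 2 := by
  have hsmall : Tendsto (fun i => s i ^ 2) l (𝓝 0) := by simpa using hs.pow 2
  have hexp : ∀ b, (fun i => Real.exp (t i b) - 1 - t i b) =O[l] fun i => s i ^ 2 := fun b =>
    (exp_sub_one_sub_isBigO.comp_tendsto ((ht b).trans_tendsto hs)).trans ((ht b).pow 2)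
  have hZ : (fun i => ∑ b, w i b * Real.exp (t i b) - 1) =O[l] fun i => s i ^ 2 := by
    refine (IsBigO.fun_sum (s := Finset.univ) fun b _ =>
      (isBigO_one_of_mem_stdSimplex hw b).mul (hexp b)).congr' ?_ (.of_forall fun i => one_mul _)
    filter_upwards [hw, hsum] with i hwi hi
    simp only [mul_sub, Finset.sum_sub_distrib, mul_one, hwi.2, hi, sub_zero]
  have hZ1 : Tendsto (fun i => ∑ b, w i b * Real.exp (t i b)) l (𝓝 1) := by
    simpa using (hZ.trans_tendsto hsmall).add_const 1
  have hbounded : (fun i => 1 + t i a) =O[l] fun _ => (1 : ℝ) :=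
    (((ht a).trans_tendsto hs).const_add 1).isBigO_one ℝ
  refine (((hZ1.inv₀ one_ne_zero).isBigO_one ℝ).mul
    ((hexp a).sub ((hbounded.mul hZ).congr_right fun _ => one_mul _))).congr' ?_
    (.of_forall fun i => one_mul _)
  filter_upwards [hZ1.eventually_ne one_ne_zero] with i hi
  field_simp
  ring

section Scale

variable {δ : ι → ℝ}

theorem isLittleO_sqrt_two_mul_iff {f : ι → ℝ} :
    f =o[l] (fun i => √(2 * δ i)) ↔ f =o[l] fun i => √(δ i) := by
  simp only [Real.sqrt_mul zero_le_two]
  exact isLittleO_const_mul_right_iff (Real.sqrt_ne_zero'.2 two_pos)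

variable (hδ : Tendsto δ l (𝓝[>] 0))
include hδ

theorem tendsto_sqrt_two_mul : Tendsto (fun i => √(2 * δ i)) l (𝓝 0) := by
  simpa using ((hδ.mono_right nhdsWithin_le_nhds).const_mul 2).sqrt

theorem sq_sqrt_two_mul_eventuallyEq : (fun i => √(2 * δ i) ^ 2) =ᶠ[l] fun i => 2 * δ i := by
  filter_upwards [hδ.eventually self_mem_nhdsWithin] with i hi
  exact Real.sq_sqrt (mul_nonneg zero_le_two (Set.mem_Ioi.1 hi).le)

theorem isBigO_sq_sqrt_two_mul_iff {f : ι → ℝ} :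
    f =O[l] (fun i => √(2 * δ i) ^ 2) ↔ f =O[l] δ :=
  (isBigO_congr EventuallyEq.rfl (sq_sqrt_two_mul_eventuallyEq hδ)).trans
    (isBigO_const_mul_right_iff two_ne_zero)

theorem isLittleO_sq_sqrt_two_mul_iff {f : ι → ℝ} :
    f =o[l] (fun i => √(2 * δ i) ^ 2) ↔ f =o[l] δ :=
  (isLittleO_congr EventuallyEq.rfl (sq_sqrt_two_mul_eventuallyEq hδ)).trans
    (isLittleO_const_mul_right_iff two_ne_zero)

end Scale

variable {𝒰 β : Type*} [Fintype 𝒰] [Fintype β] {γ : ℝ} {δ : ι → ℝ} {a h : ι → 𝒰 → ℝ}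

/-- The standing assumptions on the base laws `a i ⊗ P` and directions `h i` of a family of
members of the exponential family, at the scale `δ i → 0⁺`. -/
structure IsExpBase (l : Filter ι) (δ : ι → ℝ) (P : β → ℝ) (γ : ℝ) (a h : ι → 𝒰 → ℝ) :
    Prop where
  tendsto : Tendsto δ l (𝓝[>] 0)
  left_mem : ∀ᶠ i in l, a i ∈ stdSimplex ℝ 𝒰
  right_mem : P ∈ stdSimplex ℝ β
  lower_bound_pos : 0 < γ
  lower_bound : ∀ᶠ i in l, ∀ u, γ < a i u
  mem_unitFunctions : ∀ᶠ i in l, h i ∈ unitFunctions (a i)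

theorem IsExpBase.isBigO_one {P : β → ℝ} (H : IsExpBase l δ P γ a h) (u : 𝒰) :
    (fun i => h i u) =O[l] fun _ => (1 : ℝ) :=
  unitFunctions_isBigO_one H.lower_bound_pos H.lower_bound H.mem_unitFunctions u

variable {d : ℕ} {X : Fin d → Type*} [∀ i, Fintype (X i)] [∀ i, DecidableEq (X i)]
  {P : (∀ i, X i) → ℝ} {ψ : (Σ i, X i) → ℝ}

/-- The member of the exponential family with base law `PU ⊗ P` and direction `h`. -/
noncomputable def expLaw (P : (∀ i, X i) → ℝ) (ψ : (Σ i, X i) → ℝ) (PU : 𝒰 → ℝ) (δ : ℝ)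
    (h : 𝒰 → ℝ) (z : 𝒰 × (∀ i, X i)) : ℝ :=
  (∑ w, expWeight P ψ PU δ h w)⁻¹ * expWeight P ψ PU δ h z

/-- The relative deviation of `expLaw P ψ PU δ h` from the product law `PU ⊗ P`. -/
noncomputable def expDeviation (P : (∀ i, X i) → ℝ) (ψ : (Σ i, X i) → ℝ) (PU : 𝒰 → ℝ) (δ : ℝ)
    (h : 𝒰 → ℝ) (z : 𝒰 × (∀ i, X i)) : ℝ :=
  (∑ w, expWeight P ψ PU δ h w)⁻¹ * Real.exp (√(2 * δ) * tilt P ψ h z) - 1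

theorem expLaw_eq_mul_one_add (PU : 𝒰 → ℝ) (δ : ℝ) (h : 𝒰 → ℝ) (z : 𝒰 × (∀ i, X i)) :
    expLaw P ψ PU δ h z = PU z.1 * P z.2 * (1 + expDeviation P ψ PU δ h z) := by
  rw [expLaw, expDeviation, expWeight_eq_mul_exp_tilt]
  ring

theorem sum_expLaw {PU : 𝒰 → ℝ} (hPU : PU ∈ stdSimplex ℝ 𝒰) (hP : P ∈ stdSimplex ℝ (∀ i, X i))
    (δ : ℝ) (h : 𝒰 → ℝ) : ∑ z, expLaw P ψ PU δ h z = 1 := by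
  have hw := prod_mem_stdSimplex hPU hP
  have hZ : ∑ w, expWeight P ψ PU δ h w ≠ 0 := fun hzero => by
    simp only [expWeight_eq_mul_exp_tilt] at hzero
    rw [Finset.sum_eq_zero_iff_of_nonneg fun z _ =>
      mul_nonneg (hw.1 z) (Real.exp_pos _).le] at hzero
    exact one_ne_zero (hw.2.symm.trans (Finset.sum_eq_zero fun z hz =>
      (mul_eq_zero.1 (hzero z hz)).resolve_right (Real.exp_ne_zero _)))
  simp only [expLaw, ← Finset.mul_sum]
  exact inv_mul_cancel₀ hZ

theorem expFamily_nonempty [Nontrivial 𝒰] {PU : 𝒰 → ℝ} (hPU : PU ∈ stdSimplex ℝ 𝒰)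
    (hpos : ∀ u, 0 < PU u) (δ : ℝ) : (expFamily P ψ PU δ).Nonempty :=
  let ⟨h, hh⟩ := unitFunctions_nonempty hPU hpos
  ⟨expLaw P ψ PU δ h, h, hh, rfl⟩

namespace IsExpBase

theorem expDeviation_sub_isBigO (H : IsExpBase l δ P γ a h) (z : 𝒰 × (∀ i, X i)) :
    (fun i => expDeviation P ψ (a i) (δ i) (h i) z - √(2 * δ i) * tilt P ψ (h i) z)
      =O[l] fun i => √(2 * δ i) ^ 2 := by
  simp only [expDeviation, expWeight_eq_mul_exp_tilt]
  refine inv_sum_mul_exp_mul_exp_sub_isBigO (tendsto_sqrt_two_mul H.tendsto)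
    (H.left_mem.mono fun i hi => prod_mem_stdSimplex hi H.right_mem) ?_
    (mul_tilt_isBigO H.isBigO_one) z
  filter_upwards [H.mem_unitFunctions] with i hi
  simp only [mul_left_comm _ √(2 * δ i), ← Finset.mul_sum, sum_mul_tilt hi, mul_zero]

theorem isTilted (H : IsExpBase l δ P γ a h) :
    IsTilted l (fun i => √(2 * δ i)) P ψ a h (fun i => expLaw P ψ (a i) (δ i) (h i))
      fun i => expDeviation P ψ (a i) (δ i) (h i) where
  tendsto := tendsto_sqrt_two_mul H.tendsto
  left_mem := H.left_mem
  right_mem := H.right_mem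
  mem_unitFunctions := H.mem_unitFunctions
  isBigO_one := H.isBigO_one
  eq_mul := .of_forall fun _ => expLaw_eq_mul_one_add _ _ _
  sum_eq_one := H.left_mem.mono fun _ hi => sum_expLaw hi H.right_mem _ _
  sub_isLittleO z := (H.expDeviation_sub_isBigO z).trans_isLittleO
    ((isLittleO_pow_id one_lt_two).comp_tendsto (tendsto_sqrt_two_mul H.tendsto))

theorem marginalX_sub_isBigO (H : IsExpBase l δ P γ a h) (x : ∀ i, X i) :
    (fun i => marginalX (expLaw P ψ (a i) (δ i) (h i)) x - P x) =O[l] δ := by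
  rw [← isBigO_sq_sqrt_two_mul_iff H.tendsto]
  refine ((IsBigO.fun_sum (s := Finset.univ) fun u _ =>
    (isBigO_one_of_mem_stdSimplex H.left_mem u).mul
      (H.expDeviation_sub_isBigO (ψ := ψ) (u, x))).const_mul_left (P x)).congr' ?_
    (.of_forall fun i => one_mul _)
  filter_upwards [H.left_mem, H.mem_unitFunctions] with i ha hh
  rw [marginalX_of_eq_mul_one_add (expLaw_eq_mul_one_add _ _ _) ha.2]
  simp only [mul_sub, Finset.sum_sub_distrib, mul_left_comm _ √(2 * δ i), ← Finset.mul_sum,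
    sum_mul_tilt_left hh]
  ring

theorem marginalU_sub_isBigO (H : IsExpBase l δ P γ a h) (hψ : IsSecondEigenvector P ψ)
    (hpos : ∀ i a, 0 < coordMarginal P i a) (u : 𝒰) :
    (fun i => marginalU (expLaw P ψ (a i) (δ i) (h i)) u - a i u) =O[l] δ := by
  rw [← isBigO_sq_sqrt_two_mul_iff H.tendsto]
  refine ((isBigO_one_of_mem_stdSimplex H.left_mem u).mul (IsBigO.fun_sum (s := Finset.univ)
    fun x _ => (H.expDeviation_sub_isBigO (ψ := ψ) (u, x)).const_mul_left (P x))).congr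
    (fun i => ?_) fun i => one_mul _
  rw [marginalU_of_eq_mul_one_add (expLaw_eq_mul_one_add _ _ _) H.right_mem.2]
  simp only [mul_sub, Finset.sum_sub_distrib, mul_left_comm _ √(2 * δ i), ← Finset.mul_sum,
    sum_mul_tilt_right hψ hpos]
  ring

end IsExpBase

namespace IsTilted

variable {Q ε : ι → 𝒰 × (∀ i, X i) → ℝ}

theorem mutualInfo_sub_isLittleO_of_sqrt (H : IsTilted l (fun i => √(2 * δ i)) P ψ a h Q ε)
    (hψ : IsSecondEigenvector P ψ) (hpos : ∀ i a, 0 < coordMarginal P i a) (hev : 0 < eig P 1)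
    (hδ : Tendsto δ l (𝓝[>] 0)) : (fun i => mutualInfo (Q i) - δ i) =o[l] δ := by
  rw [← isLittleO_sq_sqrt_two_mul_iff hδ]
  refine (H.mutualInfo_sub_isLittleO hψ hpos hev).congr' ?_ EventuallyEq.rfl
  filter_upwards [sq_sqrt_two_mul_eventuallyEq hδ] with i hi
  rw [hi, mul_div_cancel_left₀ _ two_ne_zero]

theorem reduction_sub_isLittleO_of_sqrt (H : IsTilted l (fun i => √(2 * δ i)) P ψ a h Q ε)
    (hψ : IsSecondEigenvector P ψ) (hpos : ∀ i a, 0 < coordMarginal P i a) (hev : 0 < eig P 1)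
    (hδ : Tendsto δ l (𝓝[>] 0)) : (fun i => reduction (Q i) - δ i * (eig P 1 - 1)) =o[l] δ := by
  rw [← isLittleO_sq_sqrt_two_mul_iff hδ]
  refine (H.reduction_sub_isLittleO hψ hpos hev).congr' ?_ EventuallyEq.rfl
  filter_upwards [sq_sqrt_two_mul_eventuallyEq hδ] with i hi
  rw [hi, mul_div_cancel_left₀ _ two_ne_zero]

end IsTilted

end Exponential

section Linear

variable {d : ℕ} {X : Fin d → Type*} [∀ i, Fintype (X i)] [∀ i, DecidableEq (X i)]
  {P : (∀ i, X i) → ℝ} {ψ : (Σ i, X i) → ℝ} {𝒰 : Type*} {PU h : 𝒰 → ℝ}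

/-- The first-order approximation of a member of the exponential family. In contrast to the
latter, it has marginals `PU` and `P` exactly. -/
noncomputable def linearLaw (P : (∀ i, X i) → ℝ) (ψ : (Σ i, X i) → ℝ) (PU : 𝒰 → ℝ) (c : ℝ)
    (h : 𝒰 → ℝ) (z : 𝒰 × (∀ i, X i)) : ℝ :=
  PU z.1 * P z.2 * (1 + c * tilt P ψ h z)

theorem marginalU_linearLaw (hψ : IsSecondEigenvector P ψ) (hpos : ∀ i a, 0 < coordMarginal P i a)
    (hP : ∑ x, P x = 1) (c : ℝ) : marginalU (linearLaw P ψ PU c h) = PU := by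
  ext u
  rw [marginalU_of_eq_mul_one_add (Q := linearLaw P ψ PU c h) (fun _ => rfl) hP]
  simp only [mul_left_comm _ c, ← Finset.mul_sum, sum_mul_tilt_right hψ hpos, mul_zero, add_zero,
    mul_one]

variable [Fintype 𝒰]

theorem marginalX_linearLaw (hPU : ∑ u, PU u = 1) (hh : h ∈ unitFunctions PU) (c : ℝ) :
    marginalX (linearLaw P ψ PU c h) = P := by
  ext x
  rw [marginalX_of_eq_mul_one_add (Q := linearLaw P ψ PU c h) (fun _ => rfl) hPU]
  simp only [mul_left_comm _ c, ← Finset.mul_sum, sum_mul_tilt_left hh, mul_zero, add_zero,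
    mul_one]

theorem mutualInfo_linearLaw_mul_le (hψ : IsSecondEigenvector P ψ)
    (hpos : ∀ i a, 0 < coordMarginal P i a) (hP : P ∈ stdSimplex ℝ (∀ i, X i))
    (hPU : PU ∈ stdSimplex ℝ 𝒰) (hh : h ∈ unitFunctions PU) {c θ : ℝ}
    (hc : ∀ z, 0 ≤ 1 + c * tilt P ψ h z) (hθ : θ ∈ Set.Icc (0 : ℝ) 1) :
    mutualInfo (linearLaw P ψ PU (θ * c) h) ≤ θ * mutualInfo (linearLaw P ψ PU c h) := by
  simp only [mutualInfo, marginalU_linearLaw hψ hpos hP.2, marginalX_linearLaw hPU.2 hh]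
  refine le_of_eq_of_le ?_ (kl_mul_one_add_mul_le (prod_mem_stdSimplex hPU hP).1 hc ?_ hθ)
  · congr 1
    ext z
    rw [linearLaw, mul_assoc θ]
  · simp only [mul_left_comm _ c, ← Finset.mul_sum, sum_mul_tilt hh, mul_zero]

end Linear

section Construction

variable {ι : Type*} {l : Filter ι} {δ : ι → ℝ} {d : ℕ} {X : Fin d → Type*} [∀ i, Fintype (X i)]
  [∀ i, DecidableEq (X i)] {P : (∀ i, X i) → ℝ} {ψ : (Σ i, X i) → ℝ} {𝒰 : Type*} [Fintype 𝒰]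
  {γ : ℝ} {a h : ι → 𝒰 → ℝ}

theorem IsTilted.sub_law_isLittleO {s : ι → ℝ} {Q Q' ε ε' : ι → 𝒰 × (∀ i, X i) → ℝ}
    (H : IsTilted l s P ψ a h Q ε) (H' : IsTilted l s P ψ a h Q' ε') (z : 𝒰 × (∀ i, X i)) :
    (fun i => Q i z - Q' i z) =o[l] s :=
  ((H.law_sub_isLittleO z).sub (H'.law_sub_isLittleO z)).congr_left fun _ =>
    sub_sub_sub_cancel_right _ _ _

namespace IsExpBase

theorem isTilted_linearLaw (H : IsExpBase l δ P γ a h) (hψ : IsSecondEigenvector P ψ)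
    (hpos : ∀ i a, 0 < coordMarginal P i a) {θ : ι → ℝ} (hθ : Tendsto θ l (𝓝 1)) :
    IsTilted l (fun i => √(2 * δ i)) P ψ a h
      (fun i => linearLaw P ψ (a i) (θ i * √(2 * δ i)) (h i))
      fun i z => θ i * √(2 * δ i) * tilt P ψ (h i) z where
  tendsto := tendsto_sqrt_two_mul H.tendsto
  left_mem := H.left_mem
  right_mem := H.right_mem
  mem_unitFunctions := H.mem_unitFunctions
  isBigO_one := H.isBigO_one
  eq_mul := .of_forall fun _ _ => rfl
  sum_eq_one := by
    filter_upwards [H.left_mem] with i hi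
    rw [← sum_marginalU, marginalU_linearLaw hψ hpos H.right_mem.2, hi.2]
  sub_isLittleO z := by
    have hθ1 : (fun i => θ i - 1) =o[l] fun _ => (1 : ℝ) :=
      (isLittleO_one_iff ℝ).2 (by simpa using hθ.sub_const 1)
    exact (hθ1.mul_isBigO (mul_tilt_isBigO H.isBigO_one z)).congr (fun i => by ring)
      fun i => one_mul _

theorem exists_feasible_isTilted (H : IsExpBase l δ P γ a h) (hψ : IsSecondEigenvector P ψ)
    (hpos : ∀ i a, 0 < coordMarginal P i a) (hev : 0 < eig P 1) :
    ∃ Q ε, IsTilted l (fun i => √(2 * δ i)) P ψ a h Q ε ∧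
      ∀ᶠ i in l, Q i ∈ feasible 𝒰 P γ (δ i) := by
  have hT := H.isTilted_linearLaw hψ hpos (tendsto_const_nhds (x := (1 : ℝ)))
  simp only [one_mul] at hT
  set I : ι → ℝ := fun i => mutualInfo (linearLaw P ψ (a i) √(2 * δ i) (h i))
  have hδpos : ∀ᶠ i in l, 0 < δ i := H.tendsto.eventually self_mem_nhdsWithin
  have hratio : Tendsto (fun i => I i / δ i) l (𝓝 1) :=
    (isEquivalent_iff_tendsto_one (hδpos.mono fun _ hi => hi.ne')).1
      (hT.mutualInfo_sub_isLittleO_of_sqrt hψ hpos hev H.tendsto)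
  set θ : ι → ℝ := fun i => (max 1 (I i / δ i))⁻¹
  have hθ : Tendsto θ l (𝓝 1) := by
    simpa using (tendsto_const_nhds.max hratio).inv₀ (by simp : max (1 : ℝ) 1 ≠ 0)
  have hQ := H.isTilted_linearLaw hψ hpos hθ
  refine ⟨_, _, hQ, ?_⟩
  filter_upwards [hδpos, H.left_mem, H.lower_bound, H.mem_unitFunctions, hQ.sum_eq_one,
    (hQ.isPerturbation hψ hpos).eventually_nonneg,
    (hT.isPerturbation hψ hpos).eventually_one_add_nonneg] with i hδi ha haγ hh hsum hQ0 hT0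
  refine ⟨⟨hQ0, hsum⟩, marginalX_linearLaw ha.2 hh _, ?_, fun u => ?_⟩
  · have hmax : 0 < max 1 (I i / δ i) := lt_max_of_lt_left one_pos
    calc mutualInfo (linearLaw P ψ (a i) (θ i * √(2 * δ i)) (h i)) ≤ θ i * I i :=
          mutualInfo_linearLaw_mul_le hψ hpos H.right_mem ha hh hT0
            ⟨inv_nonneg.2 hmax.le, inv_le_one_of_one_le₀ (le_max_left _ _)⟩
      _ ≤ δ i := (inv_mul_le_iff₀ hmax).2 ((div_le_iff₀ hδi).1 (le_max_right _ _))
  · rw [marginalU_linearLaw hψ hpos H.right_mem.2]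
    exact haγ u

end IsExpBase

end Construction

section Bounds

variable {d : ℕ} {X : Fin d → Type*} [∀ i, Fintype (X i)]
  {P : (∀ i, X i) → ℝ} {𝒰 : Type*} [Fintype 𝒰] {Q : 𝒰 × (∀ i, X i) → ℝ} {γ : ℝ}

theorem const_inv_card_mem_stdSimplex [Nonempty 𝒰] :
    (fun _ => (Fintype.card 𝒰 : ℝ)⁻¹) ∈ stdSimplex ℝ 𝒰 :=
  ⟨fun _ => by positivity, by simp⟩

theorem lt_inv_card [Nonempty 𝒰] (hγ : γ * Fintype.card 𝒰 < 1) : γ < (Fintype.card 𝒰 : ℝ)⁻¹ := by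
  rwa [← one_div, lt_div_iff₀ (Nat.cast_pos.2 Fintype.card_pos)]

theorem feasible_nonempty [Nonempty 𝒰] (hP : P ∈ stdSimplex ℝ (∀ i, X i))
    (hγ : γ * Fintype.card 𝒰 < 1) {δ : ℝ} (hδ : 0 ≤ δ) : (feasible 𝒰 P γ δ).Nonempty := by
  set a : 𝒰 → ℝ := fun _ => (Fintype.card 𝒰 : ℝ)⁻¹
  have ha : a ∈ stdSimplex ℝ 𝒰 := const_inv_card_mem_stdSimplex
  have hU : ∀ u, marginalU (fun z => a z.1 * P z.2) u = a u := fun u => by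
    simp only [marginalU, ← Finset.mul_sum, hP.2, mul_one]
  have hX : marginalX (fun z => a z.1 * P z.2) = P := funext fun x => by
    simp only [marginalX, ← Finset.sum_mul, ha.2, one_mul]
  refine ⟨fun z => a z.1 * P z.2, prod_mem_stdSimplex ha hP, hX, ?_,
    fun u => (lt_inv_card hγ).trans_eq (hU u).symm⟩
  simp only [mutualInfo, kl, hU, hX]
  refine (Finset.sum_eq_zero fun z _ => ?_).trans_le hδ
  rcases eq_or_ne (a z.1 * P z.2) 0 with hz | hz
  · rw [hz, zero_mul]
  · rw [div_self hz, Real.log_one, mul_zero]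

variable [∀ i, DecidableEq (X i)]

theorem totalCorrelation_nonneg (hP : P ∈ stdSimplex ℝ (∀ i, X i)) : 0 ≤ totalCorrelation P := by
  have hq : ∀ x : ∀ i, X i, 0 ≤ ∏ i, coordMarginal P i (x i) := fun x =>
    Finset.prod_nonneg fun i _ => coordMarginal_nonneg hP.1 i (x i)
  refine kl_nonneg hq (fun x => div_nonneg (hP.1 x) (hq x))
    (fun x => (mul_div_cancel_of_imp' fun hx => ?_).symm) ?_
  · obtain ⟨i, -, hi⟩ := Finset.prod_eq_zero_iff.1 hx
    exact le_antisymm (hi ▸ le_coordMarginal hP.1 i x) (hP.1 x)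
  · simp only [← Fintype.prod_sum, sum_coordMarginal, hP.2, Finset.prod_const_one]

theorem reduction_le_totalCorrelation (hQ : ∀ z, 0 ≤ Q z) :
    reduction Q ≤ totalCorrelation (marginalX Q) := by
  refine sub_le_self _ (Finset.sum_nonneg fun u _ => ?_)
  rcases (marginalU_nonneg hQ u).eq_or_lt with hu | hu
  · rw [← hu, zero_mul]
  · refine mul_nonneg hu.le (totalCorrelation_nonneg ⟨fun x => div_nonneg (hQ _) hu.le, ?_⟩)
    simp only [condX, ← Finset.sum_div]
    exact div_self hu.ne'

theorem bddAbove_reduction_feasible (P : (∀ i, X i) → ℝ) (γ δ : ℝ) :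
    BddAbove (reduction '' feasible 𝒰 P γ δ) := by
  refine ⟨totalCorrelation P, Set.forall_mem_image.2 fun Q hQ => ?_⟩
  exact hQ.2.1 ▸ reduction_le_totalCorrelation hQ.1.1

end Bounds

section Deviation

variable {𝒰 β : Type*} [Fintype 𝒰] [Fintype β] {Q : 𝒰 × β → ℝ}

/-- The relative deviation of `Q` from the product of its marginals. At the points where that
product vanishes, so does `Q`, and the deviation is `0 / 0 = 0`. -/
noncomputable def deviation (Q : 𝒰 × β → ℝ) (z : 𝒰 × β) : ℝ :=
  (Q z - marginalU Q z.1 * marginalX Q z.2) / (marginalU Q z.1 * marginalX Q z.2)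

theorem eq_marginalU_mul_marginalX_mul (hQ : ∀ z, 0 ≤ Q z) (z : 𝒰 × β) :
    Q z = marginalU Q z.1 * marginalX Q z.2 * (1 + deviation Q z) := by
  rw [mul_add, mul_one, deviation, mul_div_cancel_of_imp' fun hz => ?_, add_sub_cancel]
  rw [hz, eq_zero_of_marginalU_mul_marginalX_eq_zero hQ hz, sub_zero]

theorem one_add_deviation_nonneg (hQ : ∀ z, 0 ≤ Q z) (z : 𝒰 × β) : 0 ≤ 1 + deviation Q z := by
  rcases eq_or_ne (marginalU Q z.1 * marginalX Q z.2) 0 with hz | hz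
  · simp [deviation, hz]
  · rw [deviation, sub_div, div_self hz, add_sub_cancel]
    exact div_nonneg (hQ z) (mul_nonneg (marginalU_nonneg hQ _) (marginalX_nonneg hQ _))

theorem marginalX_mul_deviation (hQ : ∀ z, 0 ≤ Q z) (u : 𝒰) (x : β) :
    marginalX Q x * deviation Q (u, x) =
      (Q (u, x) - marginalU Q u * marginalX Q x) / marginalU Q u := by
  rcases eq_or_ne (marginalX Q x) 0 with hx | hx
  · rw [eq_zero_of_marginalU_mul_marginalX_eq_zero hQ (z := (u, x)) (by simp [hx]), hx]
    simp
  · rw [deviation, mul_div_assoc', mul_comm (marginalU Q u), mul_div_mul_left _ _ hx]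

theorem marginalU_mul_deviation (hQ : ∀ z, 0 ≤ Q z) (u : 𝒰) (x : β) :
    marginalU Q u * deviation Q (u, x) =
      (Q (u, x) - marginalU Q u * marginalX Q x) / marginalX Q x := by
  rcases eq_or_ne (marginalU Q u) 0 with hu | hu
  · rw [eq_zero_of_marginalU_mul_marginalX_eq_zero hQ (z := (u, x)) (by simp [hu]), hu]
    simp
  · rw [deviation, mul_div_assoc', mul_div_mul_left _ _ hu]

theorem sum_marginalX_mul_deviation (hQ : Q ∈ stdSimplex ℝ (𝒰 × β)) (u : 𝒰) :
    ∑ x, marginalX Q x * deviation Q (u, x) = 0 := by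
  simp only [marginalX_mul_deviation hQ.1, ← Finset.sum_div, Finset.sum_sub_distrib,
    ← Finset.mul_sum, sum_marginalX, hQ.2, mul_one]
  rw [marginalU, sub_self, zero_div]

theorem sum_marginalU_mul_deviation (hQ : Q ∈ stdSimplex ℝ (𝒰 × β)) (x : β) :
    ∑ u, marginalU Q u * deviation Q (u, x) = 0 := by
  simp only [marginalU_mul_deviation hQ.1, ← Finset.sum_div, Finset.sum_sub_distrib,
    ← Finset.sum_mul, sum_marginalU, hQ.2, one_mul]
  rw [marginalX, sub_self, zero_div]

theorem mul_sq_sqrt_sub_one_le_mutualInfo (hQ : Q ∈ stdSimplex ℝ (𝒰 × β)) (z : 𝒰 × β) :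
    marginalU Q z.1 * marginalX Q z.2 * (√(1 + deviation Q z) - 1) ^ 2 ≤ mutualInfo Q :=
  have hprod := prod_mem_stdSimplex (marginalU_mem_stdSimplex hQ) (marginalX_mem_stdSimplex hQ)
  mul_sq_sqrt_sub_one_le_kl hprod.1 (one_add_deviation_nonneg hQ.1)
    (eq_marginalU_mul_marginalX_mul hQ.1) (hQ.2.trans hprod.2.symm) z

variable {ι : Type*} {l : Filter ι}

theorem isBigO_sub_one_of_sqrt {s r : ι → ℝ} (hs : Tendsto s l (𝓝 0)) (hr : ∀ᶠ i in l, 0 ≤ r i)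
    (h : (fun i => √(r i) - 1) =O[l] s) : (fun i => r i - 1) =O[l] s := by
  have hbounded : (fun i => √(r i) - 1 + 2) =O[l] fun _ => (1 : ℝ) :=
    ((h.trans_tendsto hs).add_const 2).isBigO_one ℝ
  refine (hbounded.mul h).congr' ?_ (.of_forall fun i => one_mul _)
  filter_upwards [hr] with i hi
  linear_combination Real.sq_sqrt hi

end Deviation

section Feasible

variable {ι : Type*} {l : Filter ι} {δ : ι → ℝ} {d : ℕ} {X : Fin d → Type*} [∀ i, Fintype (X i)]
  {P : (∀ i, X i) → ℝ} {𝒰 : Type*} [Fintype 𝒰] {γ : ℝ} {Q : ι → 𝒰 × (∀ i, X i) → ℝ}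

theorem deviation_isBigO (hδ : Tendsto δ l (𝓝[>] 0)) (hP : ∀ x, 0 ≤ P x) (hγ : 0 < γ)
    (hQ : ∀ᶠ i in l, Q i ∈ feasible 𝒰 P γ (δ i)) (z : 𝒰 × (∀ i, X i)) :
    (fun i => deviation (Q i) z) =O[l] fun i => √(2 * δ i) := by
  rcases (hP z.2).eq_or_lt with hz | hz
  · refine (isBigO_zero _ l).congr' ?_ EventuallyEq.rfl
    filter_upwards [hQ] with i hi
    rw [deviation, hi.2.1, ← hz, mul_zero, div_zero]
  suffices hsqrt : (fun i => √(1 + deviation (Q i) z) - 1) =O[l] fun i => √(2 * δ i) from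
    (isBigO_sub_one_of_sqrt (tendsto_sqrt_two_mul hδ)
      (hQ.mono fun i hi => one_add_deviation_nonneg hi.1.1 z) hsqrt).congr_left
      fun i => add_sub_cancel_left _ _
  refine IsBigO.of_pow two_ne_zero ((isBigO_sq_sqrt_two_mul_iff hδ).2
    (IsBigO.of_bound (γ * P z.2)⁻¹ ?_))
  filter_upwards [hQ, hδ.eventually self_mem_nhdsWithin] with i hi hδi
  rw [Pi.pow_apply, norm_pow, Real.norm_eq_abs, sq_abs, Real.norm_of_nonneg (Set.mem_Ioi.1 hδi).le,
    le_inv_mul_iff₀ (mul_pos hγ hz)]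
  calc γ * P z.2 * (√(1 + deviation (Q i) z) - 1) ^ 2
      ≤ marginalU (Q i) z.1 * marginalX (Q i) z.2 * (√(1 + deviation (Q i) z) - 1) ^ 2 := by
        rw [hi.2.1]
        gcongr
        exact (hi.2.2.2 z.1).le
    _ ≤ δ i := (mul_sq_sqrt_sub_one_le_mutualInfo hi.1 z).trans hi.2.2.1

theorem isPerturbation_of_feasible (hδ : Tendsto δ l (𝓝[>] 0)) (hP : P ∈ stdSimplex ℝ (∀ i, X i))
    (hγ : 0 < γ) (hQ : ∀ᶠ i in l, Q i ∈ feasible 𝒰 P γ (δ i)) :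
    IsPerturbation l (fun i => √(2 * δ i)) (fun i => marginalU (Q i)) P Q
      fun i => deviation (Q i) where
  tendsto := tendsto_sqrt_two_mul hδ
  left_mem := hQ.mono fun _ hi => marginalU_mem_stdSimplex hi.1
  right_mem := hP
  eq_mul := hQ.mono fun _ hi z => hi.2.1 ▸ eq_marginalU_mul_marginalX_mul hi.1.1 z
  sum_eq_one := hQ.mono fun _ hi => hi.1.2
  isBigO := deviation_isBigO hδ hP.1 hγ hQ
  sum_right_isLittleO u := (isLittleO_zero _ l).congr'
    (hQ.mono fun _ hi => hi.2.1 ▸ (sum_marginalX_mul_deviation hi.1 u).symm) EventuallyEq.rfl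
  sum_left_isLittleO x := (isLittleO_zero _ l).congr'
    (hQ.mono fun _ hi => (sum_marginalU_mul_deviation hi.1 x).symm) EventuallyEq.rfl

variable [∀ i, DecidableEq (X i)]

theorem sum_mul_energy_le {a : 𝒰 → ℝ}
    {ε : 𝒰 × (∀ i, X i) → ℝ} {c : ℝ} (ha : ∀ u, 0 ≤ a u)
    (hε : ∀ u, energy P (fun x => ε (u, x)) ≤ c * ∑ x, P x * ε (u, x) ^ 2) :
    ∑ u, a u * energy P (fun x => ε (u, x)) ≤ c * ∑ z, a z.1 * P z.2 * ε z ^ 2 := by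
  simp only [Fintype.sum_prod_type, mul_assoc, ← Finset.mul_sum]
  rw [Finset.mul_sum]
  exact Finset.sum_le_sum fun u _ =>
    (mul_le_mul_of_nonneg_left (hε u) (ha u)).trans_eq (mul_left_comm _ _ _)

theorem exists_isLittleO_reduction_sub_le (hδ : Tendsto δ l (𝓝[>] 0))
    (hP : P ∈ stdSimplex ℝ (∀ i, X i)) (hpos : ∀ i a, 0 < coordMarginal P i a)
    (hX : ∃ i, Nontrivial (X i)) (hγ : 0 < γ) (hQ : ∀ᶠ i in l, Q i ∈ feasible 𝒰 P γ (δ i)) :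
    ∃ e : ι → ℝ, e =o[l] δ ∧ ∀ᶠ i in l, reduction (Q i) - δ i * (eig P 1 - 1) ≤ e i := by
  have H := isPerturbation_of_feasible hδ hP hγ hQ
  refine ⟨_, (isLittleO_sq_sqrt_two_mul_iff hδ).1 ((H.reduction_sub_isLittleO hpos).sub
    (H.mutualInfo_sub_isLittleO.const_mul_left (eig P 1 - 1))), ?_⟩
  filter_upwards [hQ] with i hi
  have henergy := sum_mul_energy_le (marginalU_nonneg hi.1.1) fun u =>
    energy_le_eig_one hP hpos hX (hi.2.1 ▸ sum_marginalX_mul_deviation hi.1 u)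
  have hinfo := mul_le_mul_of_nonneg_right hi.2.2.1
    (sub_nonneg.2 (one_le_eig_one hP hpos hX))
  linarith

end Feasible

section OptimalValue

theorem isLittleO_of_le_of_le {ι : Type*} {l : Filter ι} {f g k x : ι → ℝ} (hf : f =o[l] g)
    (hk : k =o[l] g) (hfx : ∀ᶠ i in l, f i ≤ x i) (hxk : ∀ᶠ i in l, x i ≤ k i) : x =o[l] g := by
  refine IsBigO.trans_isLittleO (.of_bound 1 ?_) (hf.norm_left.add hk.norm_left)
  filter_upwards [hfx, hxk] with i hi hi'
  rw [one_mul, Real.norm_of_nonneg (add_nonneg (norm_nonneg (f i)) (norm_nonneg (k i)))]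
  exact abs_le_max_abs_abs hi hi' |>.trans (max_le_add_of_nonneg (abs_nonneg _) (abs_nonneg _))

variable {d : ℕ} {X : Fin d → Type*} [∀ i, Fintype (X i)] [∀ i, DecidableEq (X i)]
  {P : (∀ i, X i) → ℝ} {ψ : (Σ i, X i) → ℝ} {𝒰 : Type*} [Fintype 𝒰] {γ : ℝ}

/-- The optimal value, the supremum of `L(X^d | U)` over the feasible laws; it is `0` by
convention if there are none. -/
noncomputable def optimalValue (𝒰 : Type*) [Fintype 𝒰] (P : (∀ i, X i) → ℝ) (γ δ : ℝ) : ℝ :=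
  sSup (reduction '' feasible 𝒰 P γ δ)

theorem isLUB_optimalValue [Nonempty 𝒰] (hP : P ∈ stdSimplex ℝ (∀ i, X i))
    (hγU : γ * Fintype.card 𝒰 < 1) {δ : ℝ} (hδ : 0 ≤ δ) :
    IsLUB (reduction '' feasible 𝒰 P γ δ) (optimalValue 𝒰 P γ δ) :=
  isLUB_csSup ((feasible_nonempty hP hγU hδ).image _) (bddAbove_reduction_feasible P γ δ)

theorem exists_optimalValue_sub_isLittleO_le [Nontrivial 𝒰] (hP : P ∈ stdSimplex ℝ (∀ i, X i))
    (hpos : ∀ i a, 0 < coordMarginal P i a) (hev : 0 < eig P 1) (hγ : 0 < γ)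
    (hγU : γ * Fintype.card 𝒰 < 1) (hψ : IsSecondEigenvector P ψ) :
    ∃ e : ℝ → ℝ, e =o[𝓝[>] 0] (fun δ => δ) ∧
      ∀ᶠ δ in 𝓝[>] 0, e δ ≤ optimalValue 𝒰 P γ δ - δ * (eig P 1 - 1) := by
  have ha : (fun _ => (Fintype.card 𝒰 : ℝ)⁻¹) ∈ stdSimplex ℝ 𝒰 := const_inv_card_mem_stdSimplex
  have haγ : γ < (Fintype.card 𝒰 : ℝ)⁻¹ := lt_inv_card hγU
  obtain ⟨h, hh⟩ := unitFunctions_nonempty ha fun _ => hγ.trans haγ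
  have H : IsExpBase (𝓝[>] (0 : ℝ)) (fun δ => δ) P γ (fun _ _ => (Fintype.card 𝒰 : ℝ)⁻¹)
      fun _ => h :=
    ⟨tendsto_id, .of_forall fun _ => ha, hP, hγ, .of_forall fun _ _ => haγ, .of_forall fun _ => hh⟩
  obtain ⟨Q, ε, hQ, hfeas⟩ := H.exists_feasible_isTilted hψ hpos hev
  refine ⟨_, hQ.reduction_sub_isLittleO_of_sqrt hψ hpos hev tendsto_id, ?_⟩
  filter_upwards [hfeas] with δ hδ
  exact sub_le_sub_right
    (le_csSup (bddAbove_reduction_feasible P γ δ) (Set.mem_image_of_mem _ hδ)) _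

theorem exists_le_optimalValue_sub_isLittleO [Nonempty 𝒰] (hP : P ∈ stdSimplex ℝ (∀ i, X i))
    (hpos : ∀ i a, 0 < coordMarginal P i a) (hX : ∃ i, Nontrivial (X i)) (hγ : 0 < γ)
    (hγU : γ * Fintype.card 𝒰 < 1) :
    ∃ e : ℝ → ℝ, e =o[𝓝[>] 0] (fun δ => δ) ∧
      ∀ᶠ δ in 𝓝[>] 0, optimalValue 𝒰 P γ δ - δ * (eig P 1 - 1) ≤ e δ := by
  have hnear : ∀ᶠ δ : ℝ in 𝓝[>] 0, ∃ Q ∈ feasible 𝒰 P γ δ,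
      optimalValue 𝒰 P γ δ - δ ^ 2 < reduction Q := by
    filter_upwards [self_mem_nhdsWithin] with δ hδ
    exact (Set.exists_mem_image).1 <| exists_lt_of_lt_csSup
      ((feasible_nonempty hP hγU (Set.mem_Ioi.1 hδ).le).image _)
      (sub_lt_self _ (pow_pos (Set.mem_Ioi.1 hδ) 2))
  obtain ⟨Q, hQ⟩ := hnear.choice
  obtain ⟨e, he, hle⟩ := exists_isLittleO_reduction_sub_le tendsto_id hP hpos hX hγ
    (hQ.mono fun _ hδ => hδ.1)
  refine ⟨fun δ => e δ + δ ^ 2,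
    he.add ((isLittleO_pow_id one_lt_two).mono nhdsWithin_le_nhds), ?_⟩
  filter_upwards [hQ, hle] with δ hQδ hδ
  simp only [id] at hδ
  linarith [hQδ.2]

theorem optimalValue_sub_isLittleO [Nontrivial 𝒰] (hP : P ∈ stdSimplex ℝ (∀ i, X i))
    (hpos : ∀ i a, 0 < coordMarginal P i a) (hX : ∃ i, Nontrivial (X i)) (hγ : 0 < γ)
    (hγU : γ * Fintype.card 𝒰 < 1) (hψ : IsSecondEigenvector P ψ) :
    (fun δ => optimalValue 𝒰 P γ δ - δ * (eig P 1 - 1)) =o[𝓝[>] 0] (fun δ => δ) := by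
  have hev : 0 < eig P 1 := one_pos.trans_le (one_le_eig_one hP hpos hX)
  obtain ⟨e, he, hle⟩ := exists_optimalValue_sub_isLittleO_le hP hpos hev hγ hγU hψ
  obtain ⟨e', he', hle'⟩ := exists_le_optimalValue_sub_isLittleO hP hpos hX hγ hγU
  exact isLittleO_of_le_of_le he he' hle hle'

end OptimalValue

section Attainment

variable {ι : Type*} {l : Filter ι} {δ : ι → ℝ} {d : ℕ} {X : Fin d → Type*} [∀ i, Fintype (X i)]
  [∀ i, DecidableEq (X i)] {P : (∀ i, X i) → ℝ} {ψ : (Σ i, X i) → ℝ} {𝒰 : Type*} [Fintype 𝒰]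
  {γ : ℝ} {a : ι → 𝒰 → ℝ} {R : ι → 𝒰 × (∀ i, X i) → ℝ}

theorem exists_isExpBase_of_mem_expFamily [l.NeBot] (hδ : Tendsto δ l (𝓝[>] 0))
    (hP : P ∈ stdSimplex ℝ (∀ i, X i)) (hγ : 0 < γ)
    (hR : ∀ᶠ i in l, a i ∈ stdSimplex ℝ 𝒰 ∧ (∀ u, γ < a i u) ∧ R i ∈ expFamily P ψ (a i) (δ i)) :
    ∃ h, IsExpBase l δ P γ a h ∧ R =ᶠ[l] fun i => expLaw P ψ (a i) (δ i) (h i) := by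
  obtain ⟨h, hh⟩ := (hR.mono fun _ hi => hi.2.2).choice
  exact ⟨h, ⟨hδ, hR.mono fun _ hi => hi.1, hP, hγ, hR.mono fun _ hi => hi.2.1,
    hh.mono fun _ hi => hi.1⟩, hh.mono fun _ hi => hi.2⟩

theorem IsExpBase.exists_feasible_sub_isLittleO {h : ι → 𝒰 → ℝ} (H : IsExpBase l δ P γ a h)
    (hψ : IsSecondEigenvector P ψ) (hpos : ∀ i a, 0 < coordMarginal P i a) (hev : 0 < eig P 1) :
    ∃ Q : ι → 𝒰 × (∀ i, X i) → ℝ, (∀ᶠ i in l, Q i ∈ feasible 𝒰 P γ (δ i)) ∧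
      (fun i => reduction (Q i) - δ i * (eig P 1 - 1)) =o[l] δ ∧
      ∀ z, (fun i => Q i z - expLaw P ψ (a i) (δ i) (h i) z) =o[l] fun i => √(δ i) := by
  obtain ⟨Q, ε, hQ, hfeas⟩ := H.exists_feasible_isTilted hψ hpos hev
  exact ⟨Q, hfeas, hQ.reduction_sub_isLittleO_of_sqrt hψ hpos hev H.tendsto,
    fun z => isLittleO_sqrt_two_mul_iff.1 (hQ.sub_law_isLittleO H.isTilted z)⟩

end Attainment

section FeatureComponent

variable {d : ℕ} {X : Fin d → Type*} [∀ i, Fintype (X i)] [∀ i, DecidableEq (X i)]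
  {P : (∀ i, X i) → ℝ} {ψ : (Σ i, X i) → ℝ} {g : (∀ i, X i) → ℝ} {κ : ℝ}

/-- The coefficient of `featureSum P ψ` in the orthogonal projection of `g` onto its span in
`L²(P)`; the squared norm of `featureSum P ψ` is `eig P 1`. -/
noncomputable def featureCoef (P : (∀ i, X i) → ℝ) (ψ : (Σ i, X i) → ℝ) (g : (∀ i, X i) → ℝ) :
    ℝ :=
  (∑ x, P x * (featureSum P ψ x * g x)) / eig P 1

/-- The component of `g` orthogonal to `featureSum P ψ` in `L²(P)`. -/
noncomputable def featureResidual (P : (∀ i, X i) → ℝ) (ψ : (Σ i, X i) → ℝ)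
    (g : (∀ i, X i) → ℝ) (x : ∀ i, X i) : ℝ :=
  g x - featureCoef P ψ g * featureSum P ψ x

theorem eq_featureCoef_mul_add_featureResidual (g : (∀ i, X i) → ℝ) (x : ∀ i, X i) :
    g x = featureCoef P ψ g * featureSum P ψ x + featureResidual P ψ g x :=
  (add_sub_cancel _ _).symm

namespace IsSecondEigenvector

theorem sum_mul_featureResidual (hψ : IsSecondEigenvector P ψ)
    (hpos : ∀ i a, 0 < coordMarginal P i a) (hg : ∑ x, P x * g x = 0) :
    ∑ x, P x * featureResidual P ψ g x = 0 := by
  simp only [featureResidual, mul_sub, Finset.sum_sub_distrib, mul_left_comm (P _),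
    ← Finset.mul_sum, hψ.sum_featureSum_eq_zero hpos, hg, mul_zero, sub_zero]

theorem sum_mul_featureSum_mul_featureResidual (hψ : IsSecondEigenvector P ψ)
    (hpos : ∀ i a, 0 < coordMarginal P i a) (hev : 0 < eig P 1) (g : (∀ i, X i) → ℝ) :
    ∑ x, P x * (featureSum P ψ x * featureResidual P ψ g x) = 0 := by
  have hterm : ∀ x, P x * (featureSum P ψ x * featureResidual P ψ g x) =
      P x * (featureSum P ψ x * g x) - featureCoef P ψ g * (P x * featureSum P ψ x ^ 2) :=
    fun x => by
      rw [featureResidual]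
      ring
  simp only [hterm, Finset.sum_sub_distrib, ← Finset.mul_sum, hψ.sum_featureSum_sq hpos,
    featureCoef, div_mul_cancel₀ _ hev.ne', sub_self]

theorem sum_mul_sq_eq_add (hψ : IsSecondEigenvector P ψ) (hpos : ∀ i a, 0 < coordMarginal P i a)
    (hev : 0 < eig P 1) (g : (∀ i, X i) → ℝ) :
    ∑ x, P x * g x ^ 2 =
      eig P 1 * featureCoef P ψ g ^ 2 + ∑ x, P x * featureResidual P ψ g x ^ 2 := by
  have hterm : ∀ x, P x * g x ^ 2 = featureCoef P ψ g ^ 2 * (P x * featureSum P ψ x ^ 2) +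
      2 * featureCoef P ψ g * (P x * (featureSum P ψ x * featureResidual P ψ g x)) +
      P x * featureResidual P ψ g x ^ 2 := fun x => by
    rw [featureResidual]
    ring
  simp only [hterm, Finset.sum_add_distrib, ← Finset.mul_sum, hψ.sum_featureSum_sq hpos,
    hψ.sum_mul_featureSum_mul_featureResidual hpos hev, mul_zero, add_zero]
  rw [mul_comm (eig P 1)]

theorem energy_add_le (hψ : IsSecondEigenvector P ψ) (hP : P ∈ stdSimplex ℝ (∀ i, X i))
    (hpos : ∀ i a, 0 < coordMarginal P i a) (hκ : 0 ≤ κ) (h2 : eig P 2 ≤ κ) (h1 : κ < eig P 1)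
    (hg : ∑ x, P x * g x = 0) :
    energy P g + (eig P 1 - κ) * ∑ x, P x * featureResidual P ψ g x ^ 2 ≤
      eig P 1 * ∑ x, P x * g x ^ 2 := by
  have hev := hκ.trans_lt h1
  have horth := hψ.sum_mul_featureSum_mul_featureResidual hpos hev g
  have henergy : energy P g =
      featureCoef P ψ g ^ 2 * eig P 1 ^ 2 + energy P (featureResidual P ψ g) := by
    rw [← hψ.energy_mul_featureSum_add hP.1 hpos (featureCoef P ψ g) horth]
    exact congrArg _ (funext (eq_featureCoef_mul_add_featureResidual g))
  have hresidual := hψ.energy_le hP hpos hκ h2 h1 (hψ.sum_mul_featureResidual hpos hg) horth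
  rw [henergy, hψ.sum_mul_sq_eq_add hpos hev g]
  linarith

end IsSecondEigenvector

end FeatureComponent

section Decomposition

variable {d : ℕ} {X : Fin d → Type*} [∀ i, Fintype (X i)] [∀ i, DecidableEq (X i)]
  {P : (∀ i, X i) → ℝ} {ψ : (Σ i, X i) → ℝ} {𝒰 : Type*} [Fintype 𝒰] {a : 𝒰 → ℝ}
  {ε : 𝒰 × (∀ i, X i) → ℝ} {κ : ℝ}

/-- The part of the squared norm of `ε` in `L²(a ⊗ P)` that is carried by `featureSum P ψ`. -/
noncomputable def featureMass (P : (∀ i, X i) → ℝ) (ψ : (Σ i, X i) → ℝ) (a : 𝒰 → ℝ)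
    (ε : 𝒰 × (∀ i, X i) → ℝ) : ℝ :=
  eig P 1 * ∑ u, a u * featureCoef P ψ (fun x => ε (u, x)) ^ 2

/-- The part of the squared norm of `ε` in `L²(a ⊗ P)` that is orthogonal to
`featureSum P ψ`. -/
noncomputable def residualMass (P : (∀ i, X i) → ℝ) (ψ : (Σ i, X i) → ℝ) (a : 𝒰 → ℝ)
    (ε : 𝒰 × (∀ i, X i) → ℝ) : ℝ :=
  ∑ u, a u * ∑ x, P x * featureResidual P ψ (fun x => ε (u, x)) x ^ 2

theorem residualMass_nonneg (ha : ∀ u, 0 ≤ a u) (hP : ∀ x, 0 ≤ P x) :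
    0 ≤ residualMass P ψ a ε :=
  Finset.sum_nonneg fun u _ => mul_nonneg (ha u) <|
    Finset.sum_nonneg fun x _ => mul_nonneg (hP x) (sq_nonneg _)

/-- The normalized coefficients of `featureSum P ψ` in the functions `ε (u, ·)`, in the role of
the function `h` of a member of the exponential family. -/
noncomputable def featureDirection (P : (∀ i, X i) → ℝ) (ψ : (Σ i, X i) → ℝ) (a : 𝒰 → ℝ)
    (ε : 𝒰 × (∀ i, X i) → ℝ) (u : 𝒰) : ℝ :=
  featureCoef P ψ (fun x => ε (u, x)) * √(eig P 1) / √(featureMass P ψ a ε)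

theorem sum_mul_sq_eq_featureMass_add (hψ : IsSecondEigenvector P ψ)
    (hpos : ∀ i a, 0 < coordMarginal P i a) (hev : 0 < eig P 1) :
    ∑ z, a z.1 * P z.2 * ε z ^ 2 = featureMass P ψ a ε + residualMass P ψ a ε := by
  simp only [Fintype.sum_prod_type, mul_assoc, ← Finset.mul_sum]
  rw [featureMass, residualMass, Finset.mul_sum, ← Finset.sum_add_distrib]
  refine Finset.sum_congr rfl fun u _ => ?_
  rw [hψ.sum_mul_sq_eq_add hpos hev, mul_add, mul_left_comm]

theorem sum_mul_energy_add_le (hψ : IsSecondEigenvector P ψ) (hP : P ∈ stdSimplex ℝ (∀ i, X i))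
    (hpos : ∀ i a, 0 < coordMarginal P i a) (hκ : 0 ≤ κ) (h2 : eig P 2 ≤ κ) (h1 : κ < eig P 1)
    (ha : ∀ u, 0 ≤ a u) (hε : ∀ u, ∑ x, P x * ε (u, x) = 0) :
    ∑ u, a u * energy P (fun x => ε (u, x)) + (eig P 1 - κ) * residualMass P ψ a ε ≤
      eig P 1 * ∑ z, a z.1 * P z.2 * ε z ^ 2 := by
  simp only [residualMass, Fintype.sum_prod_type, mul_assoc, ← Finset.mul_sum]
  rw [Finset.mul_sum, Finset.mul_sum, ← Finset.sum_add_distrib]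
  refine Finset.sum_le_sum fun u _ => ?_
  rw [mul_left_comm, mul_left_comm (eig P 1), ← mul_add]
  exact mul_le_mul_of_nonneg_left (hψ.energy_add_le hP hpos hκ h2 h1 (hε u)) (ha u)

theorem sum_mul_featureCoef (hε : ∀ x, ∑ u, a u * ε (u, x) = 0) :
    ∑ u, a u * featureCoef P ψ (fun x => ε (u, x)) = 0 := by
  simp only [featureCoef, mul_div_assoc', ← Finset.sum_div, Finset.mul_sum]
  rw [Finset.sum_comm]
  have hterm : ∀ x u, a u * (P x * (featureSum P ψ x * ε (u, x))) =
      P x * featureSum P ψ x * (a u * ε (u, x)) := fun x u => by ring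
  simp only [hterm, ← Finset.mul_sum, hε, mul_zero, Finset.sum_const_zero, zero_div]

theorem featureDirection_mem_unitFunctions (hev : 0 < eig P 1) (hε : ∀ x, ∑ u, a u * ε (u, x) = 0)
    (hmass : 0 < featureMass P ψ a ε) : featureDirection P ψ a ε ∈ unitFunctions a := by
  constructor
  · simp only [featureDirection, mul_div_assoc', ← mul_assoc, ← Finset.sum_div, ← Finset.sum_mul,
      sum_mul_featureCoef hε, zero_mul, zero_div]
  · simp only [featureDirection, div_pow, mul_pow, Real.sq_sqrt hev.le, Real.sq_sqrt hmass.le,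
      mul_div_assoc', ← mul_assoc, ← Finset.sum_div, ← Finset.sum_mul]
    rw [mul_comm, ← featureMass, div_self hmass.ne']

theorem sqrt_featureMass_mul_tilt (hev : 0 < eig P 1) (hmass : 0 < featureMass P ψ a ε)
    (z : 𝒰 × (∀ i, X i)) :
    √(featureMass P ψ a ε) * tilt P ψ (featureDirection P ψ a ε) z =
      featureCoef P ψ (fun x => ε (z.1, x)) * featureSum P ψ z.2 := by
  have hev' := (Real.sqrt_pos.2 hev).ne'
  have hmass' := (Real.sqrt_pos.2 hmass).ne'
  rw [tilt, featureDirection]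
  field_simp

theorem mul_featureResidual_sq_le (ha : a ∈ stdSimplex ℝ 𝒰) (hP : P ∈ stdSimplex ℝ (∀ i, X i))
    (z : 𝒰 × (∀ i, X i)) :
    (a z.1 * P z.2 * featureResidual P ψ (fun x => ε (z.1, x)) z.2) ^ 2 ≤
      residualMass P ψ a ε := by
  have hw := prod_mem_stdSimplex ha hP
  set r : 𝒰 × (∀ i, X i) → ℝ := fun z => featureResidual P ψ (fun x => ε (z.1, x)) z.2
  calc (a z.1 * P z.2 * r z) ^ 2 = (a z.1 * P z.2) ^ 2 * r z ^ 2 := mul_pow _ _ _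
    _ ≤ a z.1 * P z.2 * r z ^ 2 := mul_le_mul_of_nonneg_right
        (pow_le_of_le_one (hw.1 z) (mem_Icc_of_mem_stdSimplex hw z).2 two_ne_zero) (sq_nonneg _)
    _ ≤ ∑ z, a z.1 * P z.2 * r z ^ 2 := Finset.single_le_sum
        (f := fun z => a z.1 * P z.2 * r z ^ 2)
        (fun z _ => mul_nonneg (hw.1 z) (sq_nonneg _)) (Finset.mem_univ z)
    _ = residualMass P ψ a ε := by
        simp only [residualMass, Fintype.sum_prod_type, mul_assoc, ← Finset.mul_sum, r]

end Decomposition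

section Stability

variable {ι : Type*} {l : Filter ι}

theorem sqrt_sub_isLittleO {A s : ι → ℝ} (hs : ∀ i, 0 ≤ s i)
    (h : (fun i => A i - s i ^ 2) =o[l] fun i => s i ^ 2) : (fun i => √(A i) - s i) =o[l] s := by
  refine IsLittleO.of_pow (n := 2) (IsBigO.trans_isLittleO (.of_bound 1 (.of_forall fun i => ?_)) h)
    two_ne_zero
  rw [Pi.pow_apply, Real.norm_eq_abs, Real.norm_eq_abs, abs_sq, one_mul]
  rcases le_total (A i) 0 with hA | hA
  · rw [Real.sqrt_eq_zero_of_nonpos hA, zero_sub, neg_sq, abs_of_nonpos] <;>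
      linarith [sq_nonneg (s i)]
  · have habs : |√(A i) - s i| ≤ |√(A i) + s i| := by
      rw [← sq_le_sq]
      nlinarith [mul_nonneg (Real.sqrt_nonneg (A i)) (hs i)]
    calc (√(A i) - s i) ^ 2 = |√(A i) - s i| * |√(A i) - s i| := by rw [← sq, sq_abs]
      _ ≤ |√(A i) + s i| * |√(A i) - s i| := mul_le_mul_of_nonneg_right habs (abs_nonneg _)
      _ = |A i - s i ^ 2| := by rw [← abs_mul, ← sq_sub_sq, Real.sq_sqrt hA]

variable {d : ℕ} {X : Fin d → Type*} [∀ i, Fintype (X i)] [∀ i, DecidableEq (X i)]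
  {P : (∀ i, X i) → ℝ} {ψ : (Σ i, X i) → ℝ} {𝒰 : Type*} [Fintype 𝒰] {δ : ι → ℝ} {γ : ℝ}
  {Q : ι → 𝒰 × (∀ i, X i) → ℝ}

/-- A family of feasible laws at the scale `δ i → 0⁺` that attains the optimal value to first
order. -/
structure IsNearOptimal (l : Filter ι) (δ : ι → ℝ) (P : (∀ i, X i) → ℝ) (γ : ℝ)
    (Q : ι → 𝒰 × (∀ i, X i) → ℝ) : Prop where
  tendsto : Tendsto δ l (𝓝[>] 0)
  mem_stdSimplex : P ∈ stdSimplex ℝ (∀ i, X i)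
  lower_bound_pos : 0 < γ
  feasible : ∀ᶠ i in l, Q i ∈ feasible 𝒰 P γ (δ i)
  reduction_sub_isLittleO : (fun i => reduction (Q i) - δ i * (eig P 1 - 1)) =o[l] δ

namespace IsNearOptimal

theorem isPerturbation (H : IsNearOptimal l δ P γ Q) :
    IsPerturbation l (fun i => √(2 * δ i)) (fun i => marginalU (Q i)) P Q
      fun i => deviation (Q i) :=
  isPerturbation_of_feasible H.tendsto H.mem_stdSimplex H.lower_bound_pos H.feasible

theorem mutualInfo_sub_isLittleO (H : IsNearOptimal l δ P γ Q) :
    (fun i => mutualInfo (Q i) -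
      (∑ z, marginalU (Q i) z.1 * P z.2 * deviation (Q i) z ^ 2) / 2) =o[l] δ :=
  (isLittleO_sq_sqrt_two_mul_iff H.tendsto).1 H.isPerturbation.mutualInfo_sub_isLittleO

theorem energy_sub_isLittleO (H : IsNearOptimal l δ P γ Q)
    (hpos : ∀ i a, 0 < coordMarginal P i a) :
    (fun i => (∑ u, marginalU (Q i) u * energy P (fun x => deviation (Q i) (u, x)) -
      ∑ z, marginalU (Q i) z.1 * P z.2 * deviation (Q i) z ^ 2) / 2 - δ i * (eig P 1 - 1))
      =o[l] δ :=
  (H.reduction_sub_isLittleO.sub ((isLittleO_sq_sqrt_two_mul_iff H.tendsto).1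
    (H.isPerturbation.reduction_sub_isLittleO hpos))).congr_left fun i => by ring

theorem residualMass_isLittleO (H : IsNearOptimal l δ P γ Q) (hψ : IsSecondEigenvector P ψ)
    (hpos : ∀ i a, 0 < coordMarginal P i a) (h1 : 1 < eig P 1) (h2 : eig P 2 < eig P 1) :
    (fun i => residualMass P ψ (marginalU (Q i)) (deviation (Q i))) =o[l] δ := by
  obtain ⟨κ, hκ, hκ1⟩ := exists_between (max_lt (one_pos.trans h1) h2)
  have hgap : 0 < eig P 1 - κ := sub_pos.2 hκ1
  refine isLittleO_of_le_of_le (isLittleO_zero _ l) (((H.energy_sub_isLittleO hpos).add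
    (H.mutualInfo_sub_isLittleO.const_mul_left (eig P 1 - 1))).const_mul_left
    (-(2 / (eig P 1 - κ)))) ?_ ?_
  · filter_upwards [H.feasible] with i hi
    exact residualMass_nonneg (marginalU_nonneg hi.1.1) H.mem_stdSimplex.1
  · filter_upwards [H.feasible] with i hi
    have henergy := sum_mul_energy_add_le hψ H.mem_stdSimplex hpos
      ((le_max_left _ _).trans hκ.le) ((le_max_right _ _).trans hκ.le) hκ1 (marginalU_nonneg hi.1.1)
      fun u => hi.2.1 ▸ sum_marginalX_mul_deviation hi.1 u
    have hinfo := mul_le_mul_of_nonneg_left hi.2.2.1 (sub_pos.2 h1).le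
    rw [neg_mul, ← mul_neg, div_mul_eq_mul_div, le_div_iff₀ hgap]
    linarith

theorem sum_mul_sq_sub_isLittleO (H : IsNearOptimal l δ P γ Q)
    (hpos : ∀ i a, 0 < coordMarginal P i a) (hX : ∃ i, Nontrivial (X i)) (h1 : 1 < eig P 1) :
    (fun i => ∑ z, marginalU (Q i) z.1 * P z.2 * deviation (Q i) z ^ 2 - 2 * δ i) =o[l] δ := by
  have hgap : 0 < eig P 1 - 1 := sub_pos.2 h1
  refine isLittleO_of_le_of_le
    ((H.energy_sub_isLittleO hpos).const_mul_left (2 / (eig P 1 - 1)))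
    (H.mutualInfo_sub_isLittleO.const_mul_left (-2)) ?_ ?_
  · filter_upwards [H.feasible] with i hi
    have henergy := sum_mul_energy_le (marginalU_nonneg hi.1.1) fun u =>
      energy_le_eig_one H.mem_stdSimplex hpos hX (hi.2.1 ▸ sum_marginalX_mul_deviation hi.1 u)
    rw [div_mul_eq_mul_div, div_le_iff₀ hgap]
    linarith
  · filter_upwards [H.feasible] with i hi
    linarith [hi.2.2.1]

theorem featureMass_sub_isLittleO (H : IsNearOptimal l δ P γ Q) (hψ : IsSecondEigenvector P ψ)
    (hpos : ∀ i a, 0 < coordMarginal P i a) (hX : ∃ i, Nontrivial (X i)) (h1 : 1 < eig P 1)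
    (h2 : eig P 2 < eig P 1) :
    (fun i => featureMass P ψ (marginalU (Q i)) (deviation (Q i)) - 2 * δ i) =o[l] δ := by
  refine ((H.sum_mul_sq_sub_isLittleO hpos hX h1).sub
    (H.residualMass_isLittleO hψ hpos h1 h2)).congr_left fun i => ?_
  rw [sum_mul_sq_eq_featureMass_add hψ hpos (one_pos.trans h1)]
  ring

theorem eventually_featureMass_pos (H : IsNearOptimal l δ P γ Q) (hψ : IsSecondEigenvector P ψ)
    (hpos : ∀ i a, 0 < coordMarginal P i a) (hX : ∃ i, Nontrivial (X i)) (h1 : 1 < eig P 1)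
    (h2 : eig P 2 < eig P 1) :
    ∀ᶠ i in l, 0 < featureMass P ψ (marginalU (Q i)) (deviation (Q i)) := by
  filter_upwards [(H.featureMass_sub_isLittleO hψ hpos hX h1 h2).def one_pos,
    H.tendsto.eventually self_mem_nhdsWithin] with i hi hδi
  replace hδi : 0 < δ i := hδi
  rw [one_mul, Real.norm_of_nonneg hδi.le] at hi
  linarith [(abs_le.1 hi).1]

theorem isExpBase (H : IsNearOptimal l δ P γ Q) (hψ : IsSecondEigenvector P ψ)
    (hpos : ∀ i a, 0 < coordMarginal P i a) (hX : ∃ i, Nontrivial (X i)) (h1 : 1 < eig P 1)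
    (h2 : eig P 2 < eig P 1) :
    IsExpBase l δ P γ (fun i => marginalU (Q i))
      fun i => featureDirection P ψ (marginalU (Q i)) (deviation (Q i)) where
  tendsto := H.tendsto
  left_mem := H.isPerturbation.left_mem
  right_mem := H.mem_stdSimplex
  lower_bound_pos := H.lower_bound_pos
  lower_bound := H.feasible.mono fun _ hi => hi.2.2.2
  mem_unitFunctions := by
    filter_upwards [H.feasible, H.eventually_featureMass_pos hψ hpos hX h1 h2] with i hi hmass
    exact featureDirection_mem_unitFunctions (one_pos.trans h1)
      (sum_marginalU_mul_deviation hi.1) hmass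

theorem mul_featureResidual_isLittleO (H : IsNearOptimal l δ P γ Q) (hψ : IsSecondEigenvector P ψ)
    (hpos : ∀ i a, 0 < coordMarginal P i a) (h1 : 1 < eig P 1) (h2 : eig P 2 < eig P 1)
    (z : 𝒰 × (∀ i, X i)) :
    (fun i => marginalU (Q i) z.1 * P z.2 *
      featureResidual P ψ (fun x => deviation (Q i) (z.1, x)) z.2)
      =o[l] fun i => √(2 * δ i) := by
  refine IsLittleO.of_pow (n := 2) (IsBigO.trans_isLittleO (.of_bound 1 ?_)
    ((isLittleO_sq_sqrt_two_mul_iff H.tendsto).2 (H.residualMass_isLittleO hψ hpos h1 h2)))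
    two_ne_zero
  filter_upwards [H.isPerturbation.left_mem] with i hi
  rw [Pi.pow_apply, one_mul, Real.norm_of_nonneg (sq_nonneg _)]
  exact (mul_featureResidual_sq_le hi H.mem_stdSimplex z).trans (le_abs_self _)

theorem sqrt_featureMass_sub_isLittleO (H : IsNearOptimal l δ P γ Q)
    (hψ : IsSecondEigenvector P ψ) (hpos : ∀ i a, 0 < coordMarginal P i a)
    (hX : ∃ i, Nontrivial (X i)) (h1 : 1 < eig P 1) (h2 : eig P 2 < eig P 1) :
    (fun i => √(featureMass P ψ (marginalU (Q i)) (deviation (Q i))) - √(2 * δ i))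
      =o[l] fun i => √(2 * δ i) := by
  refine sqrt_sub_isLittleO (fun _ => Real.sqrt_nonneg _)
    ((isLittleO_sq_sqrt_two_mul_iff H.tendsto).2
      ((H.featureMass_sub_isLittleO hψ hpos hX h1 h2).congr' ?_ EventuallyEq.rfl))
  filter_upwards [sq_sqrt_two_mul_eventuallyEq H.tendsto] with i hi
  rw [hi]

theorem law_sub_isLittleO (H : IsNearOptimal l δ P γ Q) (hψ : IsSecondEigenvector P ψ)
    (hpos : ∀ i a, 0 < coordMarginal P i a) (hX : ∃ i, Nontrivial (X i)) (h1 : 1 < eig P 1)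
    (h2 : eig P 2 < eig P 1) (z : 𝒰 × (∀ i, X i)) :
    (fun i => Q i z - marginalU (Q i) z.1 * P z.2 * (1 + √(2 * δ i) *
      tilt P ψ (featureDirection P ψ (marginalU (Q i)) (deviation (Q i))) z))
      =o[l] fun i => √(2 * δ i) := by
  have hbounded := (isBigO_one_of_mem_stdSimplex H.isPerturbation.left_mem z.1).mul
    (mul_tilt_isBigO (P := P) (ψ := ψ) (s := fun _ => (1 : ℝ))
      (H.isExpBase hψ hpos hX h1 h2).isBigO_one z)
  refine ((H.mul_featureResidual_isLittleO hψ hpos h1 h2 z).add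
    (((hbounded.const_mul_left (P z.2)).mul_isLittleO
      (H.sqrt_featureMass_sub_isLittleO hψ hpos hX h1 h2)).congr_right fun i => ?_)).congr' ?_
    EventuallyEq.rfl
  · rw [one_mul, one_mul]
  filter_upwards [H.isPerturbation.eq_mul, H.eventually_featureMass_pos hψ hpos hX h1 h2]
    with i hi hmass
  rw [hi, featureResidual, ← sqrt_featureMass_mul_tilt (one_pos.trans h1) hmass]
  ring

theorem exists_mem_expFamily_sub_isLittleO (H : IsNearOptimal l δ P γ Q)
    (hψ : IsSecondEigenvector P ψ) (hpos : ∀ i a, 0 < coordMarginal P i a)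
    (hX : ∃ i, Nontrivial (X i)) (h1 : 1 < eig P 1) (h2 : eig P 2 < eig P 1) :
    ∃ R : ι → 𝒰 × (∀ i, X i) → ℝ,
      (∀ᶠ i in l, R i ∈ expFamily P ψ (marginalU (Q i)) (δ i)) ∧
      ∀ z, (fun i => Q i z - R i z) =o[l] fun i => √(δ i) := by
  have hbase := H.isExpBase hψ hpos hX h1 h2
  refine ⟨_, hbase.mem_unitFunctions.mono fun _ hi => ⟨_, hi, rfl⟩, fun z => ?_⟩
  exact isLittleO_sqrt_two_mul_iff.1 (((H.law_sub_isLittleO hψ hpos hX h1 h2 z).sub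
    (hbase.isTilted.law_sub_isLittleO z)).congr_left fun i => sub_sub_sub_cancel_right _ _ _)

end IsNearOptimal

end Stability

end TotalCorr

theorem theorem1 {d : ℕ} {X : Fin d → Type*} [∀ i, Fintype (X i)] [∀ i, DecidableEq (X i)]
    {𝒰 : Type*} [Fintype 𝒰] [Nontrivial 𝒰]
    (P : (∀ i, X i) → ℝ) (hP : P ∈ stdSimplex ℝ (∀ i, X i))
    (hpos : ∀ i a, 0 < coordMarginal P i a) (hX : ∃ i, Nontrivial (X i))
    (γ : ℝ) (hγ : 0 < γ) (hγU : γ * Fintype.card 𝒰 < 1)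
    (ψ : (Σ i, X i) → ℝ) (hψ : IsSecondEigenvector P ψ) :
    -- the optimal value
    (∃ V : ℝ → ℝ,
      (∀ δ, 0 < δ → IsLUB (reduction '' feasible 𝒰 P γ δ) (V δ)) ∧
      (fun δ => V δ - δ * (eig P 1 - 1)) =o[𝓝[>] 0] (fun δ => δ)) ∧
    -- attainment by the members of the exponential family
    ((∀ PU ∈ stdSimplex ℝ 𝒰, (∀ u, γ < PU u) → ∀ δ, 0 < δ → (expFamily P ψ PU δ).Nonempty) ∧
      ∀ (PU : ℝ → 𝒰 → ℝ) (R : ℝ → 𝒰 × (∀ i, X i) → ℝ),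
        (∀ᶠ δ in 𝓝[>] 0, PU δ ∈ stdSimplex ℝ 𝒰 ∧ (∀ u, γ < PU δ u) ∧
          R δ ∈ expFamily P ψ (PU δ) δ) →
        (fun δ => mutualInfo (R δ) - δ) =o[𝓝[>] 0] (fun δ => δ) ∧
        (∀ x, (fun δ => marginalX (R δ) x - P x) =O[𝓝[>] 0] (fun δ => δ)) ∧
        (∀ u, (fun δ => marginalU (R δ) u - PU δ u) =O[𝓝[>] 0] (fun δ => δ)) ∧
        (fun δ => reduction (R δ) - δ * (eig P 1 - 1)) =o[𝓝[>] 0] (fun δ => δ) ∧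
        ∃ Q : ℝ → 𝒰 × (∀ i, X i) → ℝ,
          (∀ᶠ δ in 𝓝[>] 0, Q δ ∈ feasible 𝒰 P γ δ) ∧
          (fun δ => reduction (Q δ) - δ * (eig P 1 - 1)) =o[𝓝[>] 0] (fun δ => δ) ∧
          ∀ u x, (fun δ => Q δ (u, x) - R δ (u, x)) =o[𝓝[>] 0] (fun δ => Real.sqrt δ)) ∧
    -- every near-optimal joint law is close to a member of the exponential family
    (1 < eig P 1 → eig P 2 < eig P 1 →
      ∀ Q : ℝ → 𝒰 × (∀ i, X i) → ℝ,
        (∀ᶠ δ in 𝓝[>] 0, Q δ ∈ feasible 𝒰 P γ δ) →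
        (fun δ => reduction (Q δ) - δ * (eig P 1 - 1)) =o[𝓝[>] 0] (fun δ => δ) →
        ∃ R : ℝ → 𝒰 × (∀ i, X i) → ℝ,
          (∀ᶠ δ in 𝓝[>] 0, R δ ∈ expFamily P ψ (marginalU (Q δ)) δ) ∧
          ∀ u x, (fun δ => Q δ (u, x) - R δ (u, x)) =o[𝓝[>] 0] (fun δ => Real.sqrt δ)) := by
  have hev : 0 < eig P 1 := one_pos.trans_le (one_le_eig_one hP hpos hX)
  refine ⟨⟨optimalValue 𝒰 P γ, fun δ hδ => isLUB_optimalValue hP hγU hδ.le,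
    optimalValue_sub_isLittleO hP hpos hX hγ hγU hψ⟩, ⟨fun PU hPU hPUγ δ _ =>
    expFamily_nonempty hPU (fun u => hγ.trans (hPUγ u)) δ, fun PU R hR => ?_⟩,
    fun h1 h2 Q hQ hred => ?_⟩
  · obtain ⟨h, hbase, hRh⟩ :=
      exists_isExpBase_of_mem_expFamily (δ := fun δ => δ) tendsto_id hP hγ hR
    obtain ⟨Q, hfeas, hvalue, hclose⟩ := hbase.exists_feasible_sub_isLittleO hψ hpos hev
    have htilted := hbase.isTilted (ψ := ψ)
    refine ⟨(htilted.mutualInfo_sub_isLittleO_of_sqrt hψ hpos hev tendsto_id).congr' ?_ .rfl,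
      fun x => (hbase.marginalX_sub_isBigO (ψ := ψ) x).congr' ?_ .rfl,
      fun u => (hbase.marginalU_sub_isBigO hψ hpos u).congr' ?_ .rfl,
      (htilted.reduction_sub_isLittleO_of_sqrt hψ hpos hev tendsto_id).congr' ?_ .rfl,
      Q, hfeas, hvalue, fun u x => (hclose (u, x)).congr' ?_ .rfl⟩ <;>
      exact hRh.mono fun δ hδ => by simp only [hδ]
  · have H : IsNearOptimal (𝓝[>] 0) (fun δ => δ) P γ Q := ⟨tendsto_id, hP, hγ, hQ, hred⟩
    obtain ⟨R, hR, hclose⟩ := H.exists_mem_expFamily_sub_isLittleO hψ hpos hX h1 h2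
    exact ⟨R, hR, fun u x => hclose (u, x)⟩
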